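/- For an arithmetical function $f$ and real $x>1$ put $$L(x;f)=\sum_{k\le x}\frac1k\sum_{j=1}^{k}f(\gcd(k,j))\log j .$$ For real $b$ let $\mathrm{id}_b(n)=n^b$, $\phi_b=\mu*\mathrm{id}_b$ and $\sigma_b=\mathbf 1*\mathrm{id}_b$, where $*$ is Dirichlet convolution and $\mu$ is the Möbius function. Let $-1<a<0$, let $\zeta$ be the Riemann zeta function, and define $\Delta_a(x)$ by $$\sum_{n\le x}\sigma_a(n)=\zeta(1-a)x+\frac{\zeta(1+a)}{1+a}x^{1+a}-\frac{\zeta(-a)}2+\Delta_a(x).$$ Let $r(l)=\log l!-\bigl(l\log l-l+\tfrac12\log l+\log\sqrt{2\pi}\bigr)$ be the remainder in Stirling's formula. Theorem. For every $a$ with $-1<a<0$ there is a constant $\Theta=\Theta(a)$ with $0<\Theta<\frac1{12}$, namely the one given by the convergent series $\Theta\,\zeta(3+a)=\sum_{l=1}^{\infty} r(l)\,l^{-2-a}$, such that, as $x\to\infty$, $$\begin{aligned} L(x;\mathrm{id}_{1+a})={}&\frac{\zeta(1-a)}{\zeta(2)}x\log x-\frac{2\zeta(1-a)}{\zeta(2)}x+\frac{\zeta(1+a)}{(1+a)\zeta(2+a)}x^{1+a}\log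 x\\ &-\frac1{(1+a)\zeta(2+a)}\Bigl(\frac{(2+a)\zeta(1+a)}{1+a}+\frac{\zeta'(2+a)}2-\Theta\zeta(3+a)\Bigr)x^{1+a}\\ &+\frac{\log\sqrt{2\pi}}{1+a}x^{1+a}+\Bigl(\sum_{n\le x}\frac{\mu(n)}n\Delta_a\Bigl(\frac xn\Bigr)\Bigr)\log\frac xe+O_a(\log x) \end{aligned}$$ and $$\begin{aligned} L(x;\phi_{1+a})={}&\frac{\zeta(1-a)}{\zeta^2(2)}x\log x-\frac{2\zeta(1-a)}{\zeta^2(2)}x+\frac{\zeta(1+a)}{(1+a)\zeta^2(2+a)}x^{1+a}\log x\\ &-\frac1{(1+a)\zeta^2(2+a)}\Bigl(\frac{(2+a)\zeta(1+a)}{1+a}+\frac{\zeta'(2+a)}2-\Theta\zeta(3+a)\Bigr)x^{1+a}\\ &+\frac{\log\sqrt{2\pi}}{(1+a)\zeta(2+a)}x^{1+a}+\Bigl(\sum_{n\le x}\frac{(\mu*\mu)(n)}n\Delta_a\Bigl(\frac xn\Bigr)\Bigr)\log\frac xe+O_a\bigl((\log x)^3\bigr). \end{aligned}$$ -/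

import Mathlib

open Filter Asymptotics

noncomputable section

namespace LogGcdSum

/-- The Riemann zeta function at a real argument; its value there is real. -/
def zetaR (s : ℝ) : ℝ := (riemannZeta (s : ℂ)).re

/-- The derivative of the Riemann zeta function at a real argument; its value there is real. -/
def zetaR' (s : ℝ) : ℝ := (deriv riemannZeta (s : ℂ)).re

/-- The arithmetical function `n ↦ n ^ a` on the positive integers, for real `a`. -/
def idPow (a : ℝ) : ArithmeticFunction ℝ :=
  ⟨fun n => if n = 0 then 0 else (n : ℝ) ^ a, if_pos rfl⟩

/-- The real-valued Möbius function. -/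
def moebiusR : ArithmeticFunction ℝ :=
  ((ArithmeticFunction.moebius : ArithmeticFunction ℤ) : ArithmeticFunction ℝ)

/-- The Jordan totient function `φ_a = μ * id_a`. -/
def jordan (a : ℝ) : ArithmeticFunction ℝ := moebiusR * idPow a

/-- The generalized divisor function `σ_a = 1 * id_a`. -/
def sigmaR (a : ℝ) : ArithmeticFunction ℝ :=
  ((ArithmeticFunction.zeta : ArithmeticFunction ℕ) : ArithmeticFunction ℝ) * idPow a

/-- `L(x; f) = ∑_{k ≤ x} (1/k) ∑_{j=1}^{k} f(gcd(k, j)) log j`. -/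
def logGcdSum (x : ℝ) (f : ArithmeticFunction ℝ) : ℝ :=
  ∑ k ∈ Finset.Icc 1 ⌊x⌋₊,
    (1 / (k : ℝ)) * ∑ j ∈ Finset.Icc 1 k, f (Nat.gcd k j) * Real.log j

/-- The error term `Δ_a(x)` in the summatory function of `σ_a`, defined by
`∑_{n ≤ x} σ_a(n) = ζ(1-a) x + ζ(1+a)/(1+a) x^{1+a} - ζ(-a)/2 + Δ_a(x)`. -/
def Delta (a x : ℝ) : ℝ :=
  (∑ n ∈ Finset.Icc 1 ⌊x⌋₊, sigmaR a n) -
    (zetaR (1 - a) * x + zetaR (1 + a) / (1 + a) * x ^ (1 + a) - zetaR (-a) / 2)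

/-- `∑_{n ≤ x} (g(n)/n) Δ_a(x/n)`. -/
def deltaSum (g : ArithmeticFunction ℝ) (a x : ℝ) : ℝ :=
  ∑ n ∈ Finset.Icc 1 ⌊x⌋₊, g n / (n : ℝ) * Delta a (x / n)

/-- The remainder in Stirling's formula
`log l! = l log l - l + (1/2) log l + log √(2π) + stirlingRem l`. -/
def stirlingRem (l : ℕ) : ℝ :=
  Real.log (Nat.factorial l) -
    (l * Real.log l - l + 1 / 2 * Real.log l + Real.log (Real.sqrt (2 * Real.pi)))

end LogGcdSum

end

/-!
Writing `f = g * 1`, the inner sum `∑_{j ≤ k} f(gcd(k, j)) log j` splits over the divisors `d` of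
`k` into sums over the multiples of `d`, hence into values `log (k / d)!`. With `c(n) = g(n) / n`,
Stirling's formula for `log l! / l` gives `L(x; f) = (log x - 1) A(x) - B(x) + T(x)`, where
`A(x) = ∑_{n ≤ x} (c * 1)(n)`, `B(x) = ∑_{n ≤ x} (c * 1)(n) log (x / n)`, and `T` collects the terms
below `log l - 1` in Stirling's formula.

For `f = id_{1+a}` and `f = φ_{1+a}` one has `c * 1 = m * σ_a`, with `m = μ / id` taken once and
twice. So `A` and `B` are Möbius twists of `∑_{n ≤ x} σ_a(n)`, which defines `Δ_a`, and of
`∑_{n ≤ x} σ_a(n) log (x / n)`, which the hyperbola method and Euler–Maclaurin summation evaluate up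
to a multiple of `log x` and `O(1)`. A twist by `μ(n) / n` costs an error term one logarithm, but it
keeps `log x` of order `log x`, because `∑_{n ≤ x} μ(n) / n` is bounded. In `T`, the identity
`μ * log = Λ` produces `ζ'`, and the Stirling remainder produces `Θ`.
-/

noncomputable section

namespace LogGcdSum

open MeasureTheory Set Topology

/-! ### Partial summation and the sawtooth function -/

/-- The sawtooth function `ψ(t) = {t} - 1/2`, the fluctuating part of `⌊t⌋ = t - 1/2 - ψ(t)`. -/
def sawtooth (t : ℝ) : ℝ := Int.fract t - 1 / 2

/-- The continuous periodic primitive of the sawtooth function vanishing at the integers. -/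
def sawtoothPrim (t : ℝ) : ℝ := (Int.fract t ^ 2 - Int.fract t) / 2

lemma abs_sawtooth_le (t : ℝ) : |sawtooth t| ≤ 1 / 2 := by
  rw [sawtooth, abs_le]
  constructor <;> linarith [Int.fract_nonneg t, Int.fract_lt_one t]

lemma sawtoothPrim_mem_Icc (t : ℝ) : sawtoothPrim t ∈ Icc (-(1 / 8)) 0 := by
  have h₀ := Int.fract_nonneg t
  have h₁ := Int.fract_lt_one t
  rw [sawtoothPrim]
  constructor <;> nlinarith [sq_nonneg (Int.fract t - 1 / 2)]

lemma measurable_sawtooth : Measurable sawtooth :=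
  measurable_fract.sub_const _

lemma continuous_sawtoothPrim : Continuous sawtoothPrim := by
  have h : ContinuousOn (fun t : ℝ => (t ^ 2 - t) / 2) (Icc 0 1) := by fun_prop
  exact h.comp_fract'' (by norm_num)

lemma hasDerivWithinAt_sawtoothPrim (t : ℝ) :
    HasDerivWithinAt sawtoothPrim (sawtooth t) (Ioi t) t := by
  have hpoly : HasDerivAt (fun u : ℝ => ((u - ⌊t⌋) ^ 2 - (u - ⌊t⌋)) / 2) (sawtooth t) t := by
    have hsub : HasDerivAt (fun u : ℝ => u - ⌊t⌋) 1 t := (hasDerivAt_id t).sub_const _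
    refine (((hsub.pow 2).sub hsub).div_const 2).congr_deriv ?_
    rw [sawtooth, ← Int.self_sub_floor]
    norm_num
    ring
  refine hpoly.hasDerivWithinAt.congr_of_eventuallyEq ?_ ?_
  · filter_upwards [Ioo_mem_nhdsGT (Int.lt_floor_add_one t)] with u hu
    have hfloor : ⌊u⌋ = ⌊t⌋ := Int.floor_eq_iff.mpr ⟨(Int.floor_le t).trans hu.1.le, hu.2⟩
    simp only [sawtoothPrim, ← Int.self_sub_floor, hfloor]
  · simp only [sawtoothPrim, ← Int.self_sub_floor]

lemma intervalIntegrable_sawtooth (α β : ℝ) : IntervalIntegrable sawtooth volume α β := by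
  refine (intervalIntegrable_const (c := (1 / 2 : ℝ))).mono_fun
    measurable_sawtooth.aestronglyMeasurable ?_
  filter_upwards with t
  simpa using abs_sawtooth_le t

lemma abs_integral_sawtooth_mul_le {f f' : ℝ → ℝ} {α β : ℝ} (hαβ : α ≤ β)
    (hf : ∀ u ∈ Icc α β, HasDerivAt f (f' u) u) (hf' : ContinuousOn f' (Icc α β))
    (hneg : ∀ u ∈ Icc α β, f' u ≤ 0) (hβ : 0 ≤ f β) :
    |∫ u in α..β, sawtooth u * f u| ≤ f α / 8 := by
  rw [← uIcc_of_le hαβ] at hf hf'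
  have hint : IntervalIntegrable f' volume α β := hf'.intervalIntegrable
  have hdrop : ∫ u in α..β, f' u = f β - f α :=
    intervalIntegral.integral_eq_sub_of_hasDerivAt hf hint
  have hparts : ∫ u in α..β, sawtooth u * f u =
      f β * sawtoothPrim β - f α * sawtoothPrim α - ∫ u in α..β, f' u * sawtoothPrim u := by
    simp_rw [mul_comm (sawtooth _)]
    exact intervalIntegral.integral_mul_deriv_eq_deriv_mul_of_hasDeriv_right
      (fun u hu => (hf u hu).continuousAt.continuousWithinAt) continuous_sawtoothPrim.continuousOn
      (fun u hu => (hf u (Ioo_subset_Icc_self hu)).hasDerivWithinAt)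
      (fun u _ => hasDerivWithinAt_sawtoothPrim u) hint (intervalIntegrable_sawtooth α β)
  have hint' : IntervalIntegrable (fun u => f' u * sawtoothPrim u) volume α β :=
    (hf'.mul continuous_sawtoothPrim.continuousOn).intervalIntegrable
  have hlow : 0 ≤ ∫ u in α..β, f' u * sawtoothPrim u :=
    intervalIntegral.integral_nonneg hαβ fun u hu =>
      mul_nonneg_of_nonpos_of_nonpos (hneg u hu) (sawtoothPrim_mem_Icc u).2
  have hup : ∫ u in α..β, f' u * sawtoothPrim u ≤ ∫ u in α..β, f' u * (-(1 / 8)) :=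
    intervalIntegral.integral_mono_on hαβ hint' (hint.mul_const _) fun u hu =>
      mul_le_mul_of_nonpos_left (sawtoothPrim_mem_Icc u).1 (hneg u hu)
  rw [intervalIntegral.integral_mul_const, hdrop] at hup
  have hfα : 0 ≤ f α := by
    have := intervalIntegral.integral_nonneg (μ := volume) hαβ fun u hu =>
      neg_nonneg.mpr (hneg u hu)
    rw [intervalIntegral.integral_neg, hdrop] at this
    linarith
  obtain ⟨hα₁, hα₂⟩ := sawtoothPrim_mem_Icc α
  obtain ⟨hβ₁, hβ₂⟩ := sawtoothPrim_mem_Icc β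
  rw [hparts, abs_le]
  constructor <;> nlinarith [hfα]

lemma continuousOn_rpow_Icc (q : ℝ) {α β : ℝ} (hα : 0 < α) :
    ContinuousOn (fun u : ℝ => u ^ q) (Icc α β) := fun _ hu =>
  (Real.continuousAt_rpow_const _ _ (Or.inl (hα.trans_le hu.1).ne')).continuousWithinAt

lemma hasDerivAt_rpow_neg {s u : ℝ} (hu : 0 < u) :
    HasDerivAt (fun u : ℝ => u ^ (-s)) (-s * u ^ (-s - 1)) u :=
  Real.hasDerivAt_rpow_const (Or.inl hu.ne')

lemma integrableOn_sawtooth_mul_rpow {s t : ℝ} (hs : 1 < s) (ht : 0 < t) :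
    IntegrableOn (fun u => sawtooth u * u ^ (-s)) (Ioi t) := by
  refine Integrable.bdd_mul (c := 1 / 2) (integrableOn_Ioi_rpow_of_lt (by linarith) ht)
    measurable_sawtooth.aestronglyMeasurable ?_
  filter_upwards with t using abs_sawtooth_le t

lemma abs_setIntegral_Ioi_sawtooth_mul_rpow_le {s t : ℝ} (hs : 1 < s) (ht : 0 < t) :
    |∫ u in Ioi t, sawtooth u * u ^ (-s)| ≤ t ^ (-s) / 8 := by
  refine le_of_tendsto (intervalIntegral_tendsto_integral_Ioi t
    (integrableOn_sawtooth_mul_rpow hs ht) tendsto_id).abs ?_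
  filter_upwards [eventually_ge_atTop t] with T hT
  have hpos : ∀ u ∈ Icc t T, 0 < u := fun u hu => ht.trans_le hu.1
  refine abs_integral_sawtooth_mul_le hT (fun u hu => hasDerivAt_rpow_neg (hpos u hu))
    (continuousOn_const.mul (continuousOn_rpow_Icc _ ht)) (fun u hu => ?_)
    (Real.rpow_nonneg (ht.trans_le hT).le _)
  have := Real.rpow_nonneg (hpos u hu).le (-s - 1)
  nlinarith

lemma sum_Icc_mul_eq_sub_integral (c : ℕ → ℝ) {f f' : ℝ → ℝ} {b : ℝ} (hb : 1 ≤ b)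
    (hf : ∀ t ∈ Icc 1 b, HasDerivAt f (f' t) t) (hf' : ContinuousOn f' (Icc 1 b)) :
    ∑ k ∈ Finset.Icc 1 ⌊b⌋₊, f k * c k = f b * ∑ k ∈ Finset.Icc 1 ⌊b⌋₊, c k -
      ∫ t in (1 : ℝ)..b, f' t * ∑ k ∈ Finset.Icc 1 ⌊t⌋₊, c k := by
  set d : ℕ → ℝ := Function.update c 0 0 with hd
  have hsum (g : ℕ → ℝ) (n : ℕ) :
      ∑ k ∈ Finset.Icc 0 n, g k * d k = ∑ k ∈ Finset.Icc 1 n, g k * c k := by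
    rw [← Finset.insert_Icc_add_one_left_eq_Icc (Nat.zero_le n), Finset.sum_insert (by simp), hd,
      Function.update_self, mul_zero, zero_add]
    exact Finset.sum_congr rfl fun k hk => by
      rw [Function.update_of_ne (Nat.one_le_iff_ne_zero.mp (Finset.mem_Icc.mp hk).1)]
  have hsum_one (n : ℕ) : ∑ k ∈ Finset.Icc 0 n, d k = ∑ k ∈ Finset.Icc 1 n, c k := by
    simpa only [Pi.one_apply, one_mul] using hsum 1 n
  have hderiv : EqOn (deriv f) f' (Icc 1 b) := fun t ht => (hf t ht).deriv
  have habel := sum_mul_eq_sub_integral_mul₀ (𝕜 := ℝ) (f := f) d (by simp [hd]) b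
    (fun t ht => (hf t ht).differentiableAt)
    (hf'.integrableOn_Icc.congr_fun hderiv.symm measurableSet_Icc)
  rw [hsum (fun k => f k), hsum_one] at habel
  rw [habel, intervalIntegral.integral_of_le hb]
  congr 1
  refine setIntegral_congr_fun measurableSet_Ioc fun t ht => ?_
  simp only [hsum_one, hderiv (Ioc_subset_Icc_self ht)]

lemma natCast_floor_eq_sub_sawtooth {t : ℝ} (ht : 0 ≤ t) :
    (⌊t⌋₊ : ℝ) = t - 1 / 2 - sawtooth t := by
  rw [natCast_floor_eq_intCast_floor ht, sawtooth, ← Int.self_sub_floor]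
  ring

lemma sum_Icc_eq_integral_add_sawtooth {f f' : ℝ → ℝ} {t : ℝ} (ht : 1 ≤ t)
    (hf : ∀ u ∈ Icc 1 t, HasDerivAt f (f' u) u) (hf' : ContinuousOn f' (Icc 1 t)) :
    ∑ k ∈ Finset.Icc 1 ⌊t⌋₊, f k = (∫ u in (1 : ℝ)..t, f u) + f 1 / 2 - sawtooth t * f t +
      ∫ u in (1 : ℝ)..t, sawtooth u * f' u := by
  have habel := sum_Icc_mul_eq_sub_integral 1 ht hf hf'
  simp only [Pi.one_apply, mul_one, Finset.sum_const, Nat.card_Icc, add_tsub_cancel_right,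
    nsmul_eq_mul] at habel
  rw [← uIcc_of_le ht] at hf hf'
  have hint : IntervalIntegrable f' volume 1 t := hf'.intervalIntegrable
  have hparts : ∫ u in (1 : ℝ)..t, (u - 1 / 2) * f' u =
      (t - 1 / 2) * f t - (1 - 1 / 2) * f 1 - ∫ u in (1 : ℝ)..t, 1 * f u :=
    intervalIntegral.integral_mul_deriv_eq_deriv_mul
      (fun u _ => (hasDerivAt_id u).sub_const _) hf intervalIntegrable_const hint
  have hsplit : ∫ u in (1 : ℝ)..t, f' u * ⌊u⌋₊ =
      (∫ u in (1 : ℝ)..t, (u - 1 / 2) * f' u) - ∫ u in (1 : ℝ)..t, sawtooth u * f' u := by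
    rw [← intervalIntegral.integral_sub (hint.continuousOn_mul (by fun_prop))
      ((intervalIntegrable_sawtooth 1 t).mul_continuousOn hf')]
    refine intervalIntegral.integral_congr fun u hu => ?_
    rw [uIcc_of_le ht] at hu
    simp only [natCast_floor_eq_sub_sawtooth (zero_le_one.trans hu.1)]
    ring
  simp only [one_mul] at hparts
  rw [habel, hsplit, hparts, natCast_floor_eq_sub_sawtooth (zero_le_one.trans ht)]
  ring

/-! ### Dirichlet series at real arguments -/

lemma hasSum_re_of_LSeriesHasSum {f : ℕ → ℂ} {g : ℕ → ℝ} (hfg : ∀ n, n ≠ 0 → f n = g n) {s : ℝ}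
    (hs : s ≠ 0) {Z : ℂ} (h : LSeriesHasSum f s Z) :
    HasSum (fun n : ℕ => g n * (n : ℝ) ^ (-s)) Z.re := by
  refine (Complex.hasSum_re h).congr_fun fun n => ?_
  rcases eq_or_ne n 0 with rfl | hn
  · simp [Real.zero_rpow (neg_ne_zero.mpr hs)]
  · rw [LSeries.term_of_ne_zero hn, hfg n hn, ← Complex.ofReal_natCast,
      ← Complex.ofReal_cpow n.cast_nonneg, ← Complex.ofReal_div, Complex.ofReal_re,
      Real.rpow_neg n.cast_nonneg, div_eq_mul_inv]

lemma hasSum_zetaR {s : ℝ} (hs : 1 < s) : HasSum (fun n : ℕ => (n : ℝ) ^ (-s)) (zetaR s) := by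
  have h := hasSum_re_of_LSeriesHasSum (g := 1) (fun n _ => by simp) (by linarith)
    (LSeriesHasSum_one (s := s) (by simpa using hs))
  simp only [Pi.one_apply, one_mul] at h
  exact h

lemma ofReal_zetaR {s : ℝ} (hs : 1 < s) : (zetaR s : ℂ) = riemannZeta s :=
  Complex.ext rfl (by simpa using (riemannZeta_im_eq_zero_of_one_lt hs).symm)

lemma hasSum_moebius {s : ℝ} (hs : 1 < s) :
    HasSum (fun n : ℕ => moebiusR n * (n : ℝ) ^ (-s)) (1 / zetaR s) := by
  have hs' : 1 < (s : ℂ).re := by simpa using hs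
  have h := hasSum_re_of_LSeriesHasSum (g := moebiusR) (fun n _ => by simp [moebiusR])
    (by linarith) (ArithmeticFunction.LSeriesSummable_moebius_iff.mpr hs').LSeriesHasSum
  have hinv := LSeries_one_mul_Lseries_moebius hs'
  rw [LSeries_one_eq_riemannZeta hs', ← ofReal_zetaR hs] at hinv
  rwa [eq_one_div_of_mul_eq_one_right hinv, ← Complex.ofReal_one, ← Complex.ofReal_div,
    Complex.ofReal_re] at h

lemma hasSum_vonMangoldt {s : ℝ} (hs : 1 < s) :
    HasSum (fun n : ℕ => ArithmeticFunction.vonMangoldt n * (n : ℝ) ^ (-s))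
      (-zetaR' s / zetaR s) := by
  have hs' : 1 < (s : ℂ).re := by simpa using hs
  have h := hasSum_re_of_LSeriesHasSum (g := ArithmeticFunction.vonMangoldt)
    (fun n _ => rfl) (by linarith)
    (ArithmeticFunction.LSeriesSummable_vonMangoldt hs').LSeriesHasSum
  rwa [ArithmeticFunction.LSeries_vonMangoldt_eq_deriv_riemannZeta_div hs', ← ofReal_zetaR hs,
    Complex.div_ofReal_re, Complex.neg_re] at h

/-! ### Partial sums of the zeta series -/

/-- The partial sums `∑_{n ≤ t} n ^ (-s)` of the zeta series. -/
def powSum (s t : ℝ) : ℝ := ∑ n ∈ Finset.Icc 1 ⌊t⌋₊, (n : ℝ) ^ (-s)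

lemma powSum_eq_integral {s t : ℝ} (hs : s ≠ 1) (ht : 1 ≤ t) :
    powSum s t = (t ^ (1 - s) - 1) / (1 - s) + 1 / 2 - sawtooth t * t ^ (-s) -
      s * ∫ u in (1 : ℝ)..t, sawtooth u * u ^ (-(s + 1)) := by
  have h := sum_Icc_eq_integral_add_sawtooth ht
    (fun u hu => hasDerivAt_rpow_neg (s := s) (one_pos.trans_le hu.1))
    (continuousOn_const.mul (continuousOn_rpow_Icc _ one_pos))
  have hnotMem : (0 : ℝ) ∉ uIcc 1 t := by simp [uIcc_of_le ht]
  rw [integral_rpow (Or.inr ⟨neg_injective.ne hs, hnotMem⟩)] at h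
  have hconst : ∫ u in (1 : ℝ)..t, sawtooth u * (-s * u ^ (-s - 1)) =
      -s * ∫ u in (1 : ℝ)..t, sawtooth u * u ^ (-s - 1) := by
    rw [← intervalIntegral.integral_const_mul]
    congr with u
    ring
  rw [hconst, Real.one_rpow, Real.one_rpow, neg_add_eq_sub] at h
  rw [powSum, h, neg_add']
  ring

lemma tendsto_powSum {s : ℝ} (hs : 1 < s) :
    Tendsto (fun n : ℕ => powSum s n) atTop (𝓝 (zetaR s)) := by
  refine ((hasSum_zetaR hs).tendsto_sum_nat.comp (tendsto_add_atTop_nat 1)).congr fun n => ?_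
  rw [powSum, Nat.floor_natCast, Function.comp_apply, Finset.range_eq_Ico,
    Finset.Ico_add_one_right_eq_Icc, ← Finset.insert_Icc_add_one_left_eq_Icc (Nat.zero_le n),
    Finset.sum_insert (by simp), Nat.cast_zero, Real.zero_rpow (by linarith), zero_add, zero_add]

lemma zetaR_eq_integral_of_one_lt {s : ℝ} (hs : 1 < s) :
    zetaR s = -1 / (1 - s) + 1 / 2 - s * ∫ u in Ioi (1 : ℝ), sawtooth u * u ^ (-(s + 1)) := by
  have hpow : Tendsto (fun n : ℕ => (n : ℝ) ^ (1 - s)) atTop (𝓝 0) := by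
    rw [← neg_sub]
    exact (tendsto_rpow_neg_atTop (sub_pos.mpr hs)).comp tendsto_natCast_atTop_atTop
  have hsaw : Tendsto (fun n : ℕ => sawtooth n * (n : ℝ) ^ (-s)) atTop (𝓝 0) := by
    have := ((tendsto_rpow_neg_atTop (zero_lt_one.trans hs)).comp
      tendsto_natCast_atTop_atTop).const_mul (0 - 1 / 2 : ℝ)
    simpa only [mul_zero, sawtooth, Int.fract_natCast, Function.comp_apply] using this
  have hint := (intervalIntegral_tendsto_integral_Ioi 1
    (integrableOn_sawtooth_mul_rpow (s := s + 1) (by linarith) one_pos)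
    tendsto_natCast_atTop_atTop).const_mul s
  have hlim := ((((hpow.sub_const 1).div_const (1 - s)).add_const (1 / 2)).sub hsaw).sub hint
  rw [zero_sub, sub_zero] at hlim
  refine tendsto_nhds_unique (tendsto_powSum hs) (hlim.congr' ?_)
  filter_upwards [eventually_ge_atTop 1] with n hn
  exact (powSum_eq_integral hs.ne' (by exact_mod_cast hn)).symm

/-- The sawtooth function cut off to `(1, ∞)`, whose Mellin transform continues the zeta function
to `0 < Re s`. -/
def sawtoothTail : ℝ → ℂ := (Ioi (1 : ℝ)).indicator fun t => (sawtooth t : ℂ)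

lemma norm_sawtoothTail_le (t : ℝ) : ‖sawtoothTail t‖ ≤ 1 :=
  (norm_indicator_le_norm_self _ _).trans <| by
    rw [Complex.norm_real]
    exact (abs_sawtooth_le t).trans (by norm_num)

lemma locallyIntegrable_sawtoothTail : LocallyIntegrable sawtoothTail :=
  (locallyIntegrable_const (1 : ℝ)).mono
    ((Complex.measurable_ofReal.comp measurable_sawtooth).indicator
      measurableSet_Ioi).aestronglyMeasurable
    (ae_of_all _ fun t => by simpa using norm_sawtoothTail_le t)

lemma differentiableAt_mellin_sawtoothTail {s : ℂ} (hs : s.re < 0) :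
    DifferentiableAt ℂ (mellin sawtoothTail) s := by
  refine mellin_differentiableAt_of_isBigO_rpow (a := 0) (b := s.re - 1)
    (locallyIntegrable_sawtoothTail.locallyIntegrableOn _) ?_ hs ?_ (by linarith)
  · exact .of_bound 1 (Eventually.of_forall fun t => by simpa using norm_sawtoothTail_le t)
  · refine .of_bound 1 ?_
    filter_upwards [Ioo_mem_nhdsGT one_pos] with t ht
    rw [sawtoothTail, indicator_of_notMem (by simpa using ht.2.le), norm_zero]
    positivity

lemma mellin_sawtoothTail_neg (s : ℝ) :
    mellin sawtoothTail (-s) =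
      ((∫ u in Ioi (1 : ℝ), sawtooth u * u ^ (-(s + 1)) : ℝ) : ℂ) := by
  have hterm (t : ℝ) : (t : ℂ) ^ (-s - 1 : ℂ) • sawtoothTail t =
      (Ioi (1 : ℝ)).indicator (fun t : ℝ => ((sawtooth t * t ^ (-(s + 1)) : ℝ) : ℂ)) t := by
    by_cases ht : t ∈ Ioi (1 : ℝ)
    · rw [sawtoothTail, indicator_of_mem ht, indicator_of_mem ht, smul_eq_mul, mul_comm,
        Complex.ofReal_mul, Complex.ofReal_cpow (zero_le_one.trans ht.le)]
      push_cast
      rw [neg_add']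
    · rw [sawtoothTail, indicator_of_notMem ht, indicator_of_notMem ht, smul_zero]
  simp_rw [mellin, hterm]
  rw [setIntegral_indicator measurableSet_Ioi, Ioi_inter_Ioi, sup_of_le_right zero_le_one,
    integral_complex_ofReal]

lemma riemannZeta₀_eq_mellin {s : ℂ} (hs : 0 < s.re) :
    riemannZeta₀ s = 1 / 2 - s * mellin sawtoothTail (-s) := by
  have hopen : IsOpen {z : ℂ | 0 < z.re} := isOpen_lt continuous_const Complex.continuous_re
  have hdiff : DifferentiableOn ℂ (fun z : ℂ => 1 / 2 - z * mellin sawtoothTail (-z))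
      {z : ℂ | 0 < z.re} := fun z hz => by
    have hmellin : DifferentiableAt ℂ (fun z => mellin sawtoothTail (-z)) z :=
      (differentiableAt_mellin_sawtoothTail (by simpa using hz)).comp z differentiableAt_id.neg
    exact ((differentiableAt_const _).sub
      (differentiableAt_id.mul hmellin)).differentiableWithinAt
  have hreal : ∀ᶠ s : ℝ in 𝓝[≠] 2, riemannZeta₀ s = 1 / 2 - s * mellin sawtoothTail (-s) := by
    filter_upwards [nhdsWithin_le_nhds (Ioi_mem_nhds one_lt_two)] with s hs
    have hζ := riemannZeta_eq_inv_sub_add (s := s) (by exact_mod_cast (ne_of_gt hs))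
    rw [← ofReal_zetaR hs, zetaR_eq_integral_of_one_lt hs, ← neg_sub (1 : ℂ), inv_neg] at hζ
    rw [mellin_sawtoothTail_neg]
    push_cast at hζ ⊢
    linear_combination -hζ
  have htendsto : Tendsto (fun s : ℝ => (s : ℂ)) (𝓝[≠] 2) (𝓝[≠] 2) :=
    Complex.continuous_ofReal.continuousAt.continuousWithinAt.tendsto_nhdsWithin
      fun s (hs : s ≠ 2) (h : (s : ℂ) = 2) => hs (mod_cast h)
  exact (differentiable_riemannZeta₀.differentiableOn.analyticOnNhd
    hopen).eqOn_of_preconnected_of_frequently_eq (hdiff.analyticOnNhd hopen)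
    (convex_halfSpace_re_gt 0).isPreconnected (z₀ := 2) (by simp)
    (htendsto.frequently hreal.frequently) hs

lemma zetaR_eq_integral {s : ℝ} (hs : 0 < s) (hs' : s ≠ 1) :
    zetaR s = -1 / (1 - s) + 1 / 2 - s * ∫ u in Ioi (1 : ℝ), sawtooth u * u ^ (-(s + 1)) := by
  rw [zetaR, riemannZeta_eq_inv_sub_add (by exact_mod_cast hs'),
    riemannZeta₀_eq_mellin (by simpa using hs), mellin_sawtoothTail_neg, ← neg_sub, inv_neg,
    ← Complex.ofReal_re (-1 / (1 - s) + 1 / 2 - _)]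
  push_cast
  ring_nf

lemma abs_powSum_sub_le {s t : ℝ} (hs : 0 < s) (hs' : s ≠ 1) (ht : 1 ≤ t) :
    |powSum s t - (t ^ (1 - s) / (1 - s) + zetaR s - sawtooth t * t ^ (-s))| ≤
      s * t ^ (-(s + 1)) := by
  have ht₀ : 0 < t := one_pos.trans_le ht
  have hsplit := intervalIntegral.integral_interval_add_Ioi
    (integrableOn_sawtooth_mul_rpow (s := s + 1) (by linarith) one_pos)
    (integrableOn_sawtooth_mul_rpow (s := s + 1) (by linarith) ht₀)
  have htail := abs_setIntegral_Ioi_sawtooth_mul_rpow_le (s := s + 1) (by linarith) ht₀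
  have hcancel : powSum s t - (t ^ (1 - s) / (1 - s) + zetaR s - sawtooth t * t ^ (-s)) =
      s * ∫ u in Ioi t, sawtooth u * u ^ (-(s + 1)) := by
    rw [powSum_eq_integral hs' ht, zetaR_eq_integral hs hs', ← hsplit]
    ring
  rw [hcancel, abs_mul, abs_of_pos hs]
  gcongr
  linarith [Real.rpow_nonneg ht₀.le (-(s + 1))]

/-! ### Weighted summatory functions and the hyperbola method -/

/-- The weighted summatory function `x ↦ ∑_{k ≤ x} c(k) W(x / k)`. Dirichlet convolution of the
coefficients becomes composition of the operators `dsum c`. -/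
def dsum (c : ArithmeticFunction ℝ) (W : ℝ → ℝ) (x : ℝ) : ℝ :=
  ∑ k ∈ Finset.Icc 1 ⌊x⌋₊, c k * W (x / k)

section

variable (c d : ArithmeticFunction ℝ) (V W : ℝ → ℝ)

lemma one_le_div_of_mem_Icc_floor {x : ℝ} {k : ℕ} (hk : k ∈ Finset.Icc 1 ⌊x⌋₊) : 1 ≤ x / k := by
  obtain ⟨hk₁, hk₂⟩ := Finset.mem_Icc.mp hk
  rw [one_le_div₀ (by exact_mod_cast hk₁)]
  exact (Nat.le_floor_iff' (by lia)).mp hk₂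

lemma dsum_add (x : ℝ) : dsum c (fun y => V y + W y) x = dsum c V x + dsum c W x := by
  simp only [dsum, mul_add, Finset.sum_add_distrib]

lemma dsum_sub (x : ℝ) : dsum c (fun y => V y - W y) x = dsum c V x - dsum c W x := by
  simp only [dsum, mul_sub, Finset.sum_sub_distrib]

lemma dsum_const_mul (r x : ℝ) : dsum c (fun y => r * W y) x = r * dsum c W x := by
  simp only [dsum, mul_left_comm, Finset.mul_sum]

lemma dsum_const (r x : ℝ) : dsum c (fun _ => r) x = r * dsum c (fun _ => 1) x := by
  rw [← dsum_const_mul, mul_one]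

variable {V W} in
lemma dsum_congr {x : ℝ} (h : ∀ y, 1 ≤ y → V y = W y) : dsum c V x = dsum c W x :=
  Finset.sum_congr rfl fun k hk => by rw [h _ (one_le_div_of_mem_Icc_floor hk)]

lemma sum_divisorsAntidiagonal_eq_sum_Icc_div (φ : ℕ → ℕ → ℝ) (N : ℕ) :
    ∑ n ∈ Finset.Icc 1 N, ∑ p ∈ n.divisorsAntidiagonal, φ p.1 p.2 =
      ∑ i ∈ Finset.Icc 1 N, ∑ j ∈ Finset.Icc 1 (N / i), φ i j := by
  rw [Finset.sum_sigma', Finset.sum_sigma']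
  refine Finset.sum_nbij' (fun p => ⟨p.2.1, p.2.2⟩) (fun q => ⟨q.1 * q.2, q.1, q.2⟩)
    (fun ⟨n, i, j⟩ h => ?_) (fun ⟨i, j⟩ h => ?_) (fun ⟨n, i, j⟩ h => ?_) (fun _ _ => rfl)
    (fun _ _ => rfl)
  · simp only [Finset.mem_sigma, Finset.mem_Icc, Nat.mem_divisorsAntidiagonal] at h ⊢
    obtain ⟨⟨-, hN⟩, rfl, hij⟩ := h
    obtain ⟨hi, hj⟩ := mul_ne_zero_iff.mp hij
    rw [Nat.le_div_iff_mul_le (by lia), mul_comm j]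
    exact ⟨⟨by lia, (Nat.le_mul_of_pos_right i (by lia)).trans hN⟩, by lia, hN⟩
  · simp only [Finset.mem_sigma, Finset.mem_Icc, Nat.mem_divisorsAntidiagonal] at h ⊢
    obtain ⟨⟨hi, -⟩, hj, hjN⟩ := h
    rw [Nat.le_div_iff_mul_le (by lia), mul_comm] at hjN
    exact ⟨⟨Nat.mul_pos hi hj, hjN⟩, trivial, (Nat.mul_pos hi hj).ne'⟩
  · simp only [Finset.mem_sigma, Nat.mem_divisorsAntidiagonal] at h
    simp only [h.2.1]

lemma dsum_mul (x : ℝ) : dsum (c * d) W x = dsum c (dsum d W) x := by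
  have h := sum_divisorsAntidiagonal_eq_sum_Icc_div (fun i j => c i * (d j * W (x / i / j))) ⌊x⌋₊
  simp only [dsum, Nat.floor_div_natCast, Finset.mul_sum]
  rw [← h]
  refine Finset.sum_congr rfl fun n _ => ?_
  rw [ArithmeticFunction.mul_apply, Finset.sum_mul]
  refine Finset.sum_congr rfl fun p hp => ?_
  rw [← (Nat.mem_divisorsAntidiagonal.mp hp).1, Nat.cast_mul, div_div, mul_assoc]

lemma sum_Icc_div_eq_hyperbola (φ : ℕ → ℕ → ℝ) {N R S : ℕ} (hS : 1 ≤ S) (h₁ : R * S ≤ N)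
    (h₂ : N < (R + 1) * (S + 1)) :
    ∑ i ∈ Finset.Icc 1 N, ∑ j ∈ Finset.Icc 1 (N / i), φ i j =
      ∑ i ∈ Finset.Icc 1 R, ∑ j ∈ Finset.Icc 1 (N / i), φ i j +
      ∑ j ∈ Finset.Icc 1 S, ∑ i ∈ Finset.Icc 1 (N / j), φ i j -
      ∑ i ∈ Finset.Icc 1 R, ∑ j ∈ Finset.Icc 1 S, φ i j := by
  have hsplit (M : ℕ) (hRM : R ≤ M) (ψ : ℕ → ℝ) : ∑ i ∈ Finset.Icc 1 M, ψ i =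
      ∑ i ∈ Finset.Icc 1 R, ψ i + ∑ i ∈ Finset.Ioc R M, ψ i := by
    rw [← Finset.sum_union (Finset.disjoint_left.mpr fun i => by
      simp only [Finset.mem_Icc, Finset.mem_Ioc]; lia)]
    refine Finset.sum_congr ?_ fun _ _ => rfl
    ext i
    simp only [Finset.mem_union, Finset.mem_Icc, Finset.mem_Ioc]
    lia
  have hR (j : ℕ) (hj : j ∈ Finset.Icc 1 S) : R ≤ N / j := by
    rw [Finset.mem_Icc] at hj
    exact (Nat.le_div_iff_mul_le hj.1).mpr ((Nat.mul_le_mul_left R hj.2).trans h₁)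
  have hswap : ∑ i ∈ Finset.Ioc R N, ∑ j ∈ Finset.Icc 1 (N / i), φ i j =
      ∑ j ∈ Finset.Icc 1 S, ∑ i ∈ Finset.Ioc R (N / j), φ i j := by
    refine Finset.sum_comm' fun i j => ?_
    simp only [Finset.mem_Ioc, Finset.mem_Icc]
    constructor
    · rintro ⟨⟨hRi, -⟩, hj, hjN⟩
      rw [Nat.le_div_iff_mul_le (by lia)] at hjN
      have hjS : j < S + 1 := lt_of_not_ge fun h => by nlinarith
      exact ⟨⟨hRi, (Nat.le_div_iff_mul_le hj).mpr (by lia)⟩, hj, by lia⟩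
    · rintro ⟨⟨hRi, hiN⟩, hj, -⟩
      rw [Nat.le_div_iff_mul_le hj] at hiN
      exact ⟨⟨hRi, (Nat.le_mul_of_pos_right i hj).trans hiN⟩, hj,
        (Nat.le_div_iff_mul_le (by lia)).mpr (by lia)⟩
  rw [Finset.sum_comm (s := Finset.Icc 1 R) (t := Finset.Icc 1 S),
    hsplit N ((Nat.le_mul_of_pos_right R hS).trans h₁), hswap, add_sub_assoc,
    ← Finset.sum_sub_distrib]
  congr 1
  exact Finset.sum_congr rfl fun j hj => by rw [hsplit _ (hR j hj), add_sub_cancel_left]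

lemma dsum_mul_hyperbola {x y : ℝ} (hx : 0 ≤ x) (hy : 1 ≤ y) :
    dsum (c * d) W (x * y) = dsum c (fun s => dsum d W (s * y)) x +
      dsum d (fun t => dsum c W (x * t)) y -
      dsum c (fun s => dsum d (fun t => W (s * t)) y) x := by
  have hy₀ : 0 ≤ y := zero_le_one.trans hy
  have h₁ : ⌊x⌋₊ * ⌊y⌋₊ ≤ ⌊x * y⌋₊ := Nat.le_floor <| by
    push_cast
    exact mul_le_mul (Nat.floor_le hx) (Nat.floor_le hy₀) (Nat.cast_nonneg _) hx
  have h₂ : ⌊x * y⌋₊ < (⌊x⌋₊ + 1) * (⌊y⌋₊ + 1) := by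
    rw [Nat.floor_lt (mul_nonneg hx hy₀)]
    push_cast
    exact mul_lt_mul'' (Nat.lt_floor_add_one x) (Nat.lt_floor_add_one y) hx hy₀
  have h := sum_Icc_div_eq_hyperbola (fun i j => c i * (d j * W (x * y / i / j)))
    ((Nat.one_le_floor_iff y).mpr hy) h₁ h₂
  rw [dsum_mul]
  simp only [dsum, div_mul_eq_mul_div, mul_div_assoc', Nat.floor_div_natCast, Finset.mul_sum]
  rw [h]
  congr 2
  exact Finset.sum_congr rfl fun j _ => Finset.sum_congr rfl fun i _ => by
    rw [mul_left_comm, div_right_comm]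

lemma dsum_mul_log {x y : ℝ} (hx : 0 ≤ x) (hy : 1 ≤ y) :
    dsum (c * d) Real.log (x * y) = dsum c (fun s => dsum d Real.log (s * y)) x +
      dsum d (fun t => dsum c Real.log (x * t)) y -
      (dsum c Real.log x * dsum d (fun _ => 1) y +
        dsum c (fun _ => 1) x * dsum d Real.log y) := by
  have hlog : dsum c (fun s => dsum d (fun t => Real.log (s * t)) y) x =
      dsum c (fun s => Real.log s * dsum d (fun _ => 1) y + dsum d Real.log y * 1) x :=
    dsum_congr c fun s hs => by
      rw [dsum_congr d fun t ht => Real.log_mul (by linarith) (by linarith), dsum_add, dsum_const,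
        mul_one]
  rw [dsum_mul_hyperbola c d _ hx hy, hlog, dsum_add, dsum_const_mul]
  simp only [mul_comm (Real.log _), dsum_const_mul]
  ring

lemma dsum_log_eq_integral {y : ℝ} (hy : 1 ≤ y) :
    dsum c Real.log y = ∫ u in (1 : ℝ)..y, u⁻¹ * dsum c (fun _ => 1) u := by
  have habel := sum_Icc_mul_eq_sub_integral c hy
    (fun t ht => Real.hasDerivAt_log (one_pos.trans_le ht.1).ne')
    (continuousOn_id.inv₀ fun u hu => (one_pos.trans_le hu.1).ne')
  have hlog : dsum c Real.log y = Real.log y * ∑ k ∈ Finset.Icc 1 ⌊y⌋₊, c k -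
      ∑ k ∈ Finset.Icc 1 ⌊y⌋₊, Real.log k * c k := by
    rw [dsum, Finset.mul_sum, ← Finset.sum_sub_distrib]
    refine Finset.sum_congr rfl fun k hk => ?_
    have hk₀ : k ≠ 0 := (Nat.one_le_iff_ne_zero.mp (Finset.mem_Icc.mp hk).1)
    rw [Real.log_div (by linarith) (by exact_mod_cast hk₀)]
    ring
  simp only [dsum, mul_one] at hlog ⊢
  rw [hlog, habel]
  ring

end

/-! ### The remainder in Stirling's formula -/

lemma stirlingRem_eq {l : ℕ} (hl : 1 ≤ l) :
    stirlingRem l = Real.log (Stirling.stirlingSeq l) - Real.log √Real.pi := by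
  have hl₀ : (0 : ℝ) < l := by exact_mod_cast hl
  rw [Stirling.log_stirlingSeq_formula, stirlingRem, Real.log_mul two_ne_zero hl₀.ne',
    Real.log_div hl₀.ne' (Real.exp_ne_zero 1), Real.log_exp, Real.log_sqrt (by positivity),
    Real.log_sqrt (by positivity), Real.log_mul two_ne_zero Real.pi_ne_zero]
  ring

lemma stirlingRem_pos {l : ℕ} (hl : 1 ≤ l) : 0 < stirlingRem l := by
  obtain ⟨m, rfl⟩ : ∃ m, l = m + 1 := ⟨l - 1, by lia⟩
  have hdrop : 0 < Real.log (Stirling.stirlingSeq (m + 1)) -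
      Real.log (Stirling.stirlingSeq (m + 2)) :=
    lt_of_lt_of_le (by positivity)
      (le_hasSum (Stirling.log_stirlingSeq_sdiff_hasSum m) 0 fun k _ => by positivity)
  have hlim : Real.log √Real.pi ≤ Real.log (Stirling.stirlingSeq (m + 2)) :=
    Real.log_le_log (by positivity) (Stirling.sqrt_pi_le_stirlingSeq (by lia))
  rw [stirlingRem_eq hl]
  linarith

lemma tendsto_stirlingRem : Tendsto stirlingRem atTop (𝓝 0) := by
  have h := ((Real.continuousAt_log (by positivity : √Real.pi ≠ 0)).tendsto.comp
    Stirling.tendsto_stirlingSeq_sqrt_pi).sub_const (Real.log √Real.pi)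
  rw [sub_self] at h
  refine h.congr' ?_
  filter_upwards [eventually_ge_atTop 1] with l hl using (stirlingRem_eq hl).symm

lemma monotone_stirlingRem_sub :
    Monotone fun j : ℕ => stirlingRem (j + 1) - 1 / (12 * ((j : ℝ) + 1)) := by
  refine monotone_nat_of_le_succ fun j => ?_
  have h := Stirling.log_stirlingSeq_sdiff_le (j + 1)
  have htelescope : 1 / (12 * ((j : ℝ) + 1) * (j + 1 + 1)) =
      1 / (12 * (j + 1)) - 1 / (12 * (j + 1 + 1)) := by
    field_simp
    ring
  rw [stirlingRem_eq (by lia), stirlingRem_eq (by lia)]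
  push_cast at h ⊢
  linarith

lemma stirlingRem_le {l : ℕ} (hl : 1 ≤ l) : stirlingRem l ≤ 1 / (12 * l) := by
  obtain ⟨m, rfl⟩ : ∃ m, l = m + 1 := ⟨l - 1, by lia⟩
  have hlim : Tendsto (fun j : ℕ => stirlingRem (j + 1) - 1 / (12 * ((j : ℝ) + 1))) atTop
      (𝓝 0) := by
    have hinv := (tendsto_one_div_add_atTop_nhds_zero_nat (𝕜 := ℝ)).const_mul (1 / 12)
    simpa [mul_comm] using (tendsto_stirlingRem.comp (tendsto_add_atTop_nat 1)).sub hinv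
  simpa using monotone_stirlingRem_sub.ge_of_tendsto hlim m

lemma stirlingRem_one_lt : stirlingRem 1 < 1 / 12 := by
  have h : 11 / 6 < Real.log (2 * Real.pi) := by
    rw [Real.lt_log_iff_exp_lt (by positivity)]
    refine lt_of_pow_lt_pow_left₀ 6 (by positivity) ?_
    calc Real.exp (11 / 6) ^ 6 = Real.exp 1 ^ 11 := by
          rw [← Real.exp_nat_mul, ← Real.exp_nat_mul]; norm_num
      _ < 2.7182818286 ^ 11 := by gcongr; exact Real.exp_one_lt_d9
      _ < (2 * 3.14) ^ 6 := by norm_num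
      _ < (2 * Real.pi) ^ 6 := by gcongr; exact Real.pi_gt_d2
  rw [stirlingRem, Real.log_sqrt (by positivity)]
  simp only [Nat.factorial_one, Nat.cast_one, Real.log_one]
  linarith

lemma stirlingRem_div_rpow_le (a : ℝ) (l : ℕ) :
    stirlingRem (l + 1) / ((l + 1 : ℕ) : ℝ) ^ (2 + a) ≤
      1 / 12 * ((l + 1 : ℕ) : ℝ) ^ (-(3 + a)) := by
  have hl : (0 : ℝ) < ((l + 1 : ℕ) : ℝ) := by positivity
  calc stirlingRem (l + 1) / ((l + 1 : ℕ) : ℝ) ^ (2 + a)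
      ≤ 1 / (12 * ((l + 1 : ℕ) : ℝ)) / ((l + 1 : ℕ) : ℝ) ^ (2 + a) := by
        gcongr
        exact stirlingRem_le (by lia)
    _ = 1 / 12 * ((l + 1 : ℕ) : ℝ) ^ (-(3 + a)) := by
        rw [Real.rpow_neg hl.le, show 3 + a = 1 + (2 + a) by ring, Real.rpow_add hl 1 (2 + a),
          Real.rpow_one]
        field_simp

lemma hasSum_zetaR_nat_add_one {s : ℝ} (hs : 1 < s) :
    HasSum (fun l : ℕ => ((l + 1 : ℕ) : ℝ) ^ (-s)) (zetaR s) := by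
  simpa [Real.zero_rpow (by linarith : -s ≠ 0)] using (hasSum_nat_add_iff' 1).mpr (hasSum_zetaR hs)

lemma exists_hasSum_stirlingRem {a : ℝ} (ha : -2 < a) : ∃ Θ : ℝ, 0 < Θ ∧ Θ < 1 / 12 ∧
    HasSum (fun l : ℕ => stirlingRem (l + 1) / ((l + 1 : ℕ) : ℝ) ^ (2 + a))
      (Θ * zetaR (3 + a)) := by
  have hs : 1 < 3 + a := by linarith
  have hζ : 0 < zetaR (3 + a) := riemannZeta_re_pos_of_one_lt hs
  have hbound := (hasSum_zetaR_nat_add_one hs).mul_left (1 / 12)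
  have hle := stirlingRem_div_rpow_le a
  have hpos (l : ℕ) : 0 < stirlingRem (l + 1) / ((l + 1 : ℕ) : ℝ) ^ (2 + a) :=
    div_pos (stirlingRem_pos (by lia)) (by positivity)
  have hsum := Summable.of_nonneg_of_le (fun l => (hpos l).le) hle hbound.summable
  refine ⟨(∑' l : ℕ, stirlingRem (l + 1) / ((l + 1 : ℕ) : ℝ) ^ (2 + a)) / zetaR (3 + a),
    div_pos (hsum.tsum_pos (fun l => (hpos l).le) 0 (hpos 0)) hζ, ?_, ?_⟩
  · rw [div_lt_iff₀ hζ]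
    exact hasSum_lt hle (i := 0) (by simpa using stirlingRem_one_lt) hsum.hasSum hbound
  · rw [div_mul_cancel₀ _ hζ.ne']
    exact hsum.hasSum

/-! ### The summatory function of `σ_a` against the logarithm -/

lemma idPow_apply {n : ℕ} (hn : n ≠ 0) (a : ℝ) : idPow a n = (n : ℝ) ^ a := if_neg hn

lemma dsum_idPow_one (s : ℝ) : dsum (idPow (-s)) (fun _ => 1) = powSum s := by
  ext t
  refine Finset.sum_congr rfl fun n hn => ?_
  rw [idPow_apply (Nat.one_le_iff_ne_zero.mp (Finset.mem_Icc.mp hn).1), mul_one]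

lemma dsum_zeta (W : ℝ → ℝ) (x : ℝ) :
    dsum (ArithmeticFunction.zeta : ArithmeticFunction ℝ) W x =
      ∑ n ∈ Finset.Icc 1 ⌊x⌋₊, W (x / n) :=
  Finset.sum_congr rfl fun n hn => by
    rw [ArithmeticFunction.natCoe_apply,
      ArithmeticFunction.zeta_apply_ne (Nat.one_le_iff_ne_zero.mp (Finset.mem_Icc.mp hn).1),
      Nat.cast_one, one_mul]

lemma sum_log_eq_log_factorial (N : ℕ) :
    ∑ n ∈ Finset.Icc 1 N, Real.log n = Real.log N.factorial := by
  induction N with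
  | zero => simp
  | succ N ih =>
    rw [Finset.sum_Icc_succ_top (by lia), ih, Nat.factorial_succ, Nat.cast_mul, add_comm,
      Real.log_mul (by positivity) (by positivity)]

lemma dsum_zeta_log {t : ℝ} (ht : t ≠ 0) :
    dsum (ArithmeticFunction.zeta : ArithmeticFunction ℝ) Real.log t =
      ⌊t⌋₊ * Real.log t - Real.log ⌊t⌋₊.factorial := by
  have hlog : ∀ n ∈ Finset.Icc 1 ⌊t⌋₊, Real.log (t / n) = Real.log t - Real.log n :=
    fun n hn => Real.log_div ht <| by
      exact_mod_cast Nat.one_le_iff_ne_zero.mp (Finset.mem_Icc.mp hn).1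
  rw [dsum_zeta, Finset.sum_congr rfl hlog, Finset.sum_sub_distrib, sum_log_eq_log_factorial,
    Finset.sum_const, Nat.card_Icc, Nat.add_sub_cancel, nsmul_eq_mul]

lemma abs_mul_log_div_add_sub_le {n t : ℝ} (hn : 0 < n) (hnt : n ≤ t) (htn : t ≤ n + 1) :
    |n * Real.log (t / n) + n - t| ≤ t⁻¹ := by
  have ht : 0 < t := hn.trans_le hnt
  have hlower : 1 - n / t ≤ Real.log (t / n) := by
    simpa using Real.one_sub_inv_le_log_of_pos (div_pos ht hn)
  have hupper : Real.log (t / n) ≤ t / n - 1 := Real.log_le_sub_one_of_pos (div_pos ht hn)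
  have h₁ := mul_le_mul_of_nonneg_left hlower hn.le
  have h₂ := mul_le_mul_of_nonneg_left hupper hn.le
  have h₃ : n * (t / n - 1) = t - n := by field_simp
  have h₄ : n * (1 - n / t) = t - n - (t - n) ^ 2 * t⁻¹ := by field_simp; ring
  have h₅ : (t - n) ^ 2 * t⁻¹ ≤ 1 * t⁻¹ := by
    gcongr
    exact pow_le_one₀ (by linarith) (by linarith)
  rw [abs_le]
  constructor <;> linarith [inv_pos.mpr ht]

lemma dsum_zeta_log_sub_isBigO :
    (fun t => dsum (ArithmeticFunction.zeta : ArithmeticFunction ℝ) Real.log t -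
      (t - Real.log t / 2 - Real.log √(2 * Real.pi))) =O[𝓟 (Ici 1)] fun t => t⁻¹ := by
  refine isBigO_principal.mpr ⟨2, fun t (ht : 1 ≤ t) => ?_⟩
  have ht₀ : 0 < t := one_pos.trans_le ht
  have hfloor : 1 ≤ ⌊t⌋₊ := (Nat.one_le_floor_iff t).mpr ht
  have hrem : |_| ≤ t⁻¹ := abs_mul_log_div_add_sub_le (by exact_mod_cast hfloor)
    (Nat.floor_le ht₀.le) (Nat.lt_floor_add_one t).le
  have hn : (1 : ℝ) ≤ ⌊t⌋₊ := by exact_mod_cast hfloor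
  have hnt := Nat.floor_le ht₀.le
  have htn := Nat.lt_floor_add_one t
  have hr := stirlingRem_pos hfloor
  have hr' := stirlingRem_le hfloor
  set n : ℝ := (⌊t⌋₊ : ℝ)
  have hn₀ : 0 < n := by linarith
  have hP : dsum (ArithmeticFunction.zeta : ArithmeticFunction ℝ) Real.log t -
      (t - Real.log t / 2 - Real.log √(2 * Real.pi)) =
      (n * Real.log (t / n) + n - t) + Real.log (t / n) / 2 - stirlingRem ⌊t⌋₊ := by
    rw [dsum_zeta_log ht₀.ne', stirlingRem, Real.log_div ht₀.ne' hn₀.ne']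
    ring
  have hlog : 0 ≤ Real.log (t / n) := Real.log_nonneg ((one_le_div₀ hn₀).mpr hnt)
  have hlog' : Real.log (t / n) ≤ n⁻¹ := by
    refine (Real.log_le_sub_one_of_pos (div_pos ht₀ hn₀)).trans ?_
    field_simp
    linarith
  have hinv : n⁻¹ ≤ 2 * t⁻¹ := by
    field_simp
    linarith
  have hr₁ : 1 / (12 * n) = n⁻¹ / 12 := by field_simp
  rw [hP, Real.norm_eq_abs, Real.norm_of_nonneg (inv_pos.mpr ht₀).le]
  rw [abs_le] at hrem ⊢
  constructor <;> linarith

section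

variable {s : ℝ}

lemma powSum_sub_isBigO (hs : 0 < s) (hs' : s ≠ 1) :
    (fun t => powSum s t - (t ^ (1 - s) / (1 - s) + zetaR s - sawtooth t * t ^ (-s)))
      =O[𝓟 (Ici 1)] fun t => t ^ (-(s + 1)) :=
  isBigO_principal.mpr ⟨s, fun t (ht : 1 ≤ t) => by
    rw [Real.norm_of_nonneg (Real.rpow_nonneg (zero_le_one.trans ht) _)]
    exact abs_powSum_sub_le hs hs' ht⟩

lemma measurable_powSum (s : ℝ) : Measurable (powSum s) :=
  (measurable_from_nat (f := fun N => ∑ n ∈ Finset.Icc 1 N, (n : ℝ) ^ (-s))).comp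
    Nat.measurable_floor

/-- The remainder of `powSum s` after its two leading terms. -/
def powSumRem (s t : ℝ) : ℝ := powSum s t - (t ^ (1 - s) / (1 - s) + zetaR s)

lemma inv_mul_powSumRem_add_sawtooth_isBigO (hs : 0 < s) (hs' : s ≠ 1) :
    (fun t => t⁻¹ * powSumRem s t + sawtooth t * t ^ (-(s + 1))) =O[𝓟 (Ici 1)]
      fun t => t ^ (-(s + 2)) := by
  refine ((isBigO_refl (fun t : ℝ => t⁻¹) _).mul (powSum_sub_isBigO hs hs')).congr'
    (eventually_principal.mpr fun t (ht : 1 ≤ t) => ?_)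
    (eventually_principal.mpr fun t (ht : 1 ≤ t) => ?_)
  · simp only [powSumRem, neg_add, Real.rpow_add (one_pos.trans_le ht), Real.rpow_neg_one]
    ring
  · simp only [show -(s + 2) = -1 + -(s + 1) by ring, Real.rpow_add (one_pos.trans_le ht) (-1),
      Real.rpow_neg_one]

lemma integrableOn_inv_mul_powSumRem (hs : 0 < s) (hs' : s ≠ 1) :
    IntegrableOn (fun u => u⁻¹ * powSumRem s u) (Ioi 1) := by
  obtain ⟨C, hC⟩ := isBigO_principal.mp (inv_mul_powSumRem_add_sawtooth_isBigO hs hs')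
  have hmeas := measurable_powSum s
  have hsaw := measurable_sawtooth
  have hrem : IntegrableOn (fun u => u⁻¹ * powSumRem s u + sawtooth u * u ^ (-(s + 1))) (Ioi 1) :=
    ((integrableOn_Ioi_rpow_of_lt (by linarith : -(s + 2) < -1) one_pos).norm.const_mul C).mono'
      (by unfold powSumRem; fun_prop)
      ((ae_restrict_iff' measurableSet_Ioi).mpr
        (ae_of_all _ fun u hu => hC u (mem_Ici.mpr (le_of_lt hu))))
  exact (hrem.sub (integrableOn_sawtooth_mul_rpow (s := s + 1) (by linarith) one_pos)).congr
    (ae_of_all _ fun u => by simp)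

lemma setIntegral_Ioi_inv_mul_powSumRem_isBigO (hs : 0 < s) (hs' : s ≠ 1) :
    (fun t => ∫ u in Ioi t, u⁻¹ * powSumRem s u) =O[𝓟 (Ici 1)] fun t => t ^ (-(s + 1)) := by
  obtain ⟨C, hC⟩ := isBigO_principal.mp (inv_mul_powSumRem_add_sawtooth_isBigO hs hs')
  refine isBigO_principal.mpr ⟨C / (s + 1) + 1 / 8, fun t (ht : 1 ≤ t) => ?_⟩
  have ht₀ : 0 < t := one_pos.trans_le ht
  have hsaw := integrableOn_sawtooth_mul_rpow (s := s + 1) (by linarith) ht₀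
  have hsplit := integral_add
    ((integrableOn_inv_mul_powSumRem hs hs').mono_set (Ioi_subset_Ioi ht)) hsaw
  have hint : IntegrableOn (fun u : ℝ => C * u ^ (-(s + 2))) (Ioi t) :=
    (integrableOn_Ioi_rpow_of_lt (by linarith) ht₀).const_mul C
  have hrem : |∫ u in Ioi t, (u⁻¹ * powSumRem s u + sawtooth u * u ^ (-(s + 1)))| ≤
      C / (s + 1) * t ^ (-(s + 1)) := by
    calc |∫ u in Ioi t, (u⁻¹ * powSumRem s u + sawtooth u * u ^ (-(s + 1)))|
        ≤ ∫ u in Ioi t, C * u ^ (-(s + 2)) := by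
          rw [← Real.norm_eq_abs]
          refine norm_integral_le_of_norm_le hint
            ((ae_restrict_iff' measurableSet_Ioi).mpr (ae_of_all _ fun u hu => ?_))
          have hu₁ : 1 ≤ u := ht.trans (le_of_lt hu)
          rw [← Real.norm_of_nonneg (Real.rpow_nonneg (zero_le_one.trans hu₁) (-(s + 2)))]
          exact hC u hu₁
      _ = C / (s + 1) * t ^ (-(s + 1)) := by
          rw [integral_const_mul, integral_Ioi_rpow_of_lt (by linarith) ht₀,
            show -(s + 2) + 1 = -(s + 1) by ring, neg_div_neg_eq]
          ring
  have htail := abs_setIntegral_Ioi_sawtooth_mul_rpow_le (s := s + 1) (by linarith) ht₀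
  rw [Real.norm_eq_abs, Real.norm_of_nonneg (by positivity)]
  rw [abs_le] at hrem htail ⊢
  constructor <;> linarith

lemma dsum_idPow_log_eq (hs : 0 < s) (hs' : s ≠ 1) {t : ℝ} (ht : 1 ≤ t) :
    dsum (idPow (-s)) Real.log t = (t ^ (1 - s) - 1) / (1 - s) ^ 2 + zetaR s * Real.log t +
      ∫ u in (1 : ℝ)..t, u⁻¹ * powSumRem s u := by
  have hs₁ : 1 - s ≠ 0 := sub_ne_zero.mpr hs'.symm
  have hnotMem : (0 : ℝ) ∉ uIcc 1 t := by simp [uIcc_of_le ht]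
  have hpow : IntervalIntegrable (fun u : ℝ => u ^ (-s)) volume 1 t :=
    intervalIntegral.intervalIntegrable_rpow (Or.inr hnotMem)
  have hinv : IntervalIntegrable (fun u : ℝ => u⁻¹) volume 1 t :=
    intervalIntegral.intervalIntegrable_inv (fun u hu => ne_of_mem_of_not_mem hu hnotMem)
      continuousOn_id
  have hrem : IntervalIntegrable (fun u => u⁻¹ * powSumRem s u) volume 1 t :=
    (intervalIntegrable_iff_integrableOn_Ioc_of_le ht).mpr
      ((integrableOn_inv_mul_powSumRem hs hs').mono_set Ioc_subset_Ioi_self)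
  have hintegrand : EqOn (fun u => u⁻¹ * dsum (idPow (-s)) (fun _ => 1) u)
      (fun u => u ^ (-s) / (1 - s) + zetaR s * u⁻¹ + u⁻¹ * powSumRem s u) (uIcc 1 t) := by
    intro u hu
    rw [uIcc_of_le ht] at hu
    have hu₀ : 0 < u := one_pos.trans_le hu.1
    simp only [dsum_idPow_one, powSumRem, sub_eq_add_neg 1 s, Real.rpow_add hu₀, Real.rpow_one]
    field_simp
    ring
  rw [dsum_log_eq_integral _ ht, intervalIntegral.integral_congr hintegrand,
    intervalIntegral.integral_add ((hpow.div_const _).add (hinv.const_mul _)) hrem,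
    intervalIntegral.integral_add (hpow.div_const _) (hinv.const_mul _),
    intervalIntegral.integral_div, intervalIntegral.integral_const_mul,
    integral_inv_of_pos one_pos (one_pos.trans_le ht), div_one,
    integral_rpow (Or.inr ⟨by contrapose! hs'; linarith, hnotMem⟩), neg_add_eq_sub, Real.one_rpow,
    div_div, sq]

lemma exists_dsum_idPow_log_sub_isBigO (hs : 0 < s) (hs' : s ≠ 1) :
    ∃ K : ℝ, (fun t => dsum (idPow (-s)) Real.log t -
      (t ^ (1 - s) / (1 - s) ^ 2 + zetaR s * Real.log t + K)) =O[𝓟 (Ici 1)]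
        fun t => t ^ (-(s + 1)) := by
  refine ⟨(∫ u in Ioi 1, u⁻¹ * powSumRem s u) - 1 / (1 - s) ^ 2, ?_⟩
  refine (setIntegral_Ioi_inv_mul_powSumRem_isBigO hs hs').neg_left.congr'
    (eventually_principal.mpr fun t (ht : 1 ≤ t) => ?_) EventuallyEq.rfl
  have hsplit := intervalIntegral.integral_interval_add_Ioi (integrableOn_inv_mul_powSumRem hs hs')
    ((integrableOn_inv_mul_powSumRem hs hs').mono_set (Ioi_subset_Ioi ht))
  simp only [dsum_idPow_log_eq hs hs' ht]
  linear_combination -hsplit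

end

lemma rpow_isBigO_rpow {p q : ℝ} (hpq : p ≤ q) :
    (fun t : ℝ => t ^ p) =O[𝓟 (Ici 1)] fun t => t ^ q :=
  isBigO_principal.mpr ⟨1, fun t (ht : 1 ≤ t) => by
    have ht₀ : 0 ≤ t := zero_le_one.trans ht
    rw [one_mul, Real.norm_of_nonneg (Real.rpow_nonneg ht₀ p),
      Real.norm_of_nonneg (Real.rpow_nonneg ht₀ q)]
    exact Real.rpow_le_rpow_of_exponent_le ht hpq⟩

lemma abs_zeta_le_one (n : ℕ) : |(ArithmeticFunction.zeta : ArithmeticFunction ℝ) n| ≤ 1 := by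
  rw [ArithmeticFunction.natCoe_apply, ArithmeticFunction.zeta_apply]
  split_ifs <;> simp

lemma abs_idPow_le_one {a : ℝ} (ha : a ≤ 0) (n : ℕ) : |idPow a n| ≤ 1 := by
  rcases eq_or_ne n 0 with rfl | hn
  · simp
  · rw [idPow_apply hn, abs_of_nonneg (Real.rpow_nonneg (Nat.cast_nonneg n) a)]
    exact Real.rpow_le_one_of_one_le_of_nonpos (by exact_mod_cast Nat.one_le_iff_ne_zero.mpr hn) ha

lemma dsum_comp_mul_isBigO_one {c : ArithmeticFunction ℝ} (hc : ∀ n, |c n| ≤ 1) {P : ℝ → ℝ}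
    (hP : P =O[𝓟 (Ici 1)] fun t => t⁻¹) :
    (fun v => dsum c (fun t => P (v * t)) v) =O[𝓟 (Ici 1)] fun _ => (1 : ℝ) := by
  obtain ⟨C, hC⟩ := isBigO_principal.mp hP
  refine isBigO_principal.mpr ⟨C, fun v (hv : 1 ≤ v) => ?_⟩
  have hv₀ : 0 < v := one_pos.trans_le hv
  have hC₀ : 0 ≤ C := by simpa using (norm_nonneg _).trans (hC 1 (mem_Ici.mpr le_rfl))
  have hterm : ∀ n ∈ Finset.Icc 1 ⌊v⌋₊, |c n * P (v * (v / n))| ≤ C * v⁻¹ := fun n hn => by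
    have ht := one_le_div_of_mem_Icc_floor hn
    have hvt : v ≤ v * (v / n) := le_mul_of_one_le_right hv₀.le ht
    calc |c n * P (v * (v / n))| ≤ 1 * (C * (v * (v / n))⁻¹) := by
          rw [abs_mul, ← abs_of_pos (inv_pos.mpr (hv₀.trans_le hvt))]
          exact mul_le_mul (hc n) (hC _ (hv.trans hvt)) (abs_nonneg _) zero_le_one
      _ ≤ C * v⁻¹ := by
          rw [one_mul]
          gcongr
  calc ‖dsum c (fun t => P (v * t)) v‖ ≤ ∑ _n ∈ Finset.Icc 1 ⌊v⌋₊, C * v⁻¹ :=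
        (Finset.abs_sum_le_sum_abs _ _).trans (Finset.sum_le_sum hterm)
    _ ≤ v * (C * v⁻¹) := by
        rw [Finset.sum_const, Nat.card_Icc, Nat.add_sub_cancel, nsmul_eq_mul]
        gcongr
        exact Nat.floor_le hv₀.le
    _ = C * ‖(1 : ℝ)‖ := by
        rw [norm_one]
        field_simp

lemma dsum_rpow (c : ArithmeticFunction ℝ) (s : ℝ) {x : ℝ} (hx : 0 ≤ x) :
    dsum c (fun y => y ^ s) x = x ^ s * ∑ n ∈ Finset.Icc 1 ⌊x⌋₊, c n * (n : ℝ) ^ (-s) := by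
  rw [dsum, Finset.mul_sum]
  refine Finset.sum_congr rfl fun n _ => ?_
  rw [Real.div_rpow hx (Nat.cast_nonneg n), Real.rpow_neg (Nat.cast_nonneg n)]
  ring

lemma dsum_zeta_rpow (s : ℝ) {x : ℝ} (hx : 0 ≤ x) :
    dsum (ArithmeticFunction.zeta : ArithmeticFunction ℝ) (fun y => y ^ s) x =
      x ^ s * powSum s x := by
  rw [dsum_zeta, powSum, Finset.mul_sum]
  refine Finset.sum_congr rfl fun n _ => ?_
  rw [Real.div_rpow hx (Nat.cast_nonneg n), Real.rpow_neg (Nat.cast_nonneg n), div_eq_mul_inv]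

lemma dsum_zeta_one (x : ℝ) :
    dsum (ArithmeticFunction.zeta : ArithmeticFunction ℝ) (fun _ => 1) x = ⌊x⌋₊ := by
  simp [dsum_zeta]

lemma dsum_idPow_id (a x : ℝ) : dsum (idPow a) (fun y => y) x = x * powSum (1 - a) x := by
  rw [dsum, powSum, Finset.mul_sum]
  refine Finset.sum_congr rfl fun n hn => ?_
  have hn₀ : n ≠ 0 := Nat.one_le_iff_ne_zero.mp (Finset.mem_Icc.mp hn).1
  rw [idPow_apply hn₀, neg_sub, Real.rpow_sub_one (by exact_mod_cast hn₀)]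
  ring

lemma dsum_idPow_comp_mul_sub {G P : ℝ → ℝ} {K : ℝ}
    (hG : ∀ t, G t = t - Real.log t / 2 - K + P t) (a : ℝ) {v : ℝ} (hv : 1 ≤ v) :
    dsum (idPow a) (fun t => G (v * t)) v - powSum (-a) v * G v =
      v ^ 2 * powSum (1 - a) v - dsum (idPow a) Real.log v / 2 - v * powSum (-a) v +
        (dsum (idPow a) (fun t => P (v * t)) v - powSum (-a) v * P v) := by
  have hv₀ : 0 < v := one_pos.trans_le hv
  have hcongr : dsum (idPow a) (fun t => G (v * t)) v = dsum (idPow a)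
      (fun t => v * t - (1 / 2 * Real.log t + (Real.log v / 2 + K)) + P (v * t)) v :=
    dsum_congr _ fun t ht => by
      rw [hG, Real.log_mul hv₀.ne' (by linarith)]
      ring
  have hone := congr_fun (dsum_idPow_one (-a)) v
  rw [neg_neg] at hone
  rw [hcongr, dsum_add, dsum_sub, dsum_add, dsum_const_mul, dsum_const_mul, dsum_const, hone,
    dsum_idPow_id, hG]
  ring

lemma dsum_zeta_comp_mul_sub {H Q : ℝ → ℝ} {s α z K : ℝ}
    (hH : ∀ t, H t = α * t ^ s + z * Real.log t + K + Q t) {v : ℝ} (hv : 1 ≤ v) :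
    dsum (ArithmeticFunction.zeta : ArithmeticFunction ℝ) (fun t => H (v * t)) v - ⌊v⌋₊ * H v =
      α * (v ^ s) ^ 2 * powSum s v - α * ⌊v⌋₊ * v ^ s +
        z * dsum (ArithmeticFunction.zeta : ArithmeticFunction ℝ) Real.log v +
        (dsum (ArithmeticFunction.zeta : ArithmeticFunction ℝ) (fun t => Q (v * t)) v -
          ⌊v⌋₊ * Q v) := by
  have hv₀ : 0 < v := one_pos.trans_le hv
  have hcongr : dsum (ArithmeticFunction.zeta : ArithmeticFunction ℝ) (fun t => H (v * t)) v =
      dsum (ArithmeticFunction.zeta : ArithmeticFunction ℝ)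
        (fun t => α * v ^ s * t ^ s + z * Real.log t + (z * Real.log v + K) + Q (v * t)) v :=
    dsum_congr _ fun t ht => by
      rw [hH, Real.log_mul hv₀.ne' (by linarith), Real.mul_rpow hv₀.le (by linarith)]
      ring
  rw [hcongr, dsum_add, dsum_add, dsum_add, dsum_const_mul, dsum_const_mul, dsum_const,
    dsum_zeta_rpow _ hv₀.le, dsum_zeta_one, hH]
  ring

lemma isBigO_rpow_mul_of_isBigO {f : ℝ → ℝ} {p q : ℝ} (hf : f =O[𝓟 (Ici 1)] fun t => t ^ q)
    (hpq : p + q ≤ 0) : (fun t => t ^ p * f t) =O[𝓟 (Ici 1)] fun _ => (1 : ℝ) := by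
  have hmul : (fun t : ℝ => t ^ (p + q)) =ᶠ[𝓟 (Ici 1)] fun t => t ^ p * t ^ q :=
    eventually_principal.mpr fun t (ht : 1 ≤ t) => Real.rpow_add (one_pos.trans_le ht) p q
  have hone : (fun t : ℝ => t ^ (0 : ℝ)) = fun _ => 1 := funext Real.rpow_zero
  exact ((isBigO_refl (fun t : ℝ => t ^ p) _).mul hf).trans
    (hone ▸ (rpow_isBigO_rpow hpq).congr' hmul EventuallyEq.rfl)

/-- The remainder of `powSum s` after its Euler–Maclaurin expansion up to the sawtooth term. -/
def powSumErr (s t : ℝ) : ℝ :=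
  powSum s t - (t ^ (1 - s) / (1 - s) + zetaR s - sawtooth t * t ^ (-s))

-- The contributions of orders `v ^ (2 + a)`, `v ^ (1 + a)` (sawtooth terms included) and `v` all
-- cancel.
lemma powSum_expansion_collapse {a v : ℝ} (ha : -1 < a) (ha' : a < 0) (hv : 1 ≤ v) :
    v ^ 2 * powSum (1 - a) v + 1 / (1 + a) ^ 2 * (v ^ (1 + a)) ^ 2 * powSum (1 + a) v -
        v * powSum (-a) v - 1 / (1 + a) ^ 2 * ⌊v⌋₊ * v ^ (1 + a) -
        1 / (1 + a) ^ 2 * v ^ (1 + a) / 2 + zetaR (-a) * v =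
      zetaR (1 - a) * v ^ 2 + zetaR (1 + a) / (1 + a) ^ 2 * (v ^ (1 + a)) ^ 2 +
        (v ^ (2 : ℝ) * powSumErr (1 - a) v +
          1 / (1 + a) ^ 2 * (v ^ (2 * (1 + a)) * powSumErr (1 + a) v) -
          v ^ (1 : ℝ) * powSumErr (-a) v) := by
  have hv₀ : 0 < v := one_pos.trans_le hv
  have hb : 1 + a ≠ 0 := by linarith
  have ha₀ := ha'.ne
  rw [natCast_floor_eq_sub_sawtooth hv₀.le]
  simp only [powSumErr, neg_sub, neg_neg, neg_add, sub_neg_eq_add, sub_sub_cancel,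
    sub_add_cancel_left, sub_eq_add_neg a 1, Real.rpow_add hv₀, Real.rpow_one, Real.rpow_two,
    Real.rpow_neg hv₀.le a, mul_add, mul_one, two_mul a, Real.rpow_neg hv₀.le]
  have hw : v ^ a ≠ 0 := (Real.rpow_pos_of_pos hv₀ a).ne'
  field_simp
  ring

lemma inv_isBigO_one : (fun t : ℝ => t⁻¹) =O[𝓟 (Ici 1)] fun _ => (1 : ℝ) := by
  simpa only [Real.rpow_neg_one, Real.rpow_zero] using
    rpow_isBigO_rpow (neg_nonpos.mpr zero_le_one)

lemma dsum_one_isBigO_id {c : ArithmeticFunction ℝ} (hc : ∀ n, |c n| ≤ 1) :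
    dsum c (fun _ => 1) =O[𝓟 (Ici 1)] fun v => v := by
  refine isBigO_principal.mpr ⟨1, fun v (hv : 1 ≤ v) => ?_⟩
  have hv₀ : 0 ≤ v := zero_le_one.trans hv
  calc ‖dsum c (fun _ => 1) v‖ ≤ ∑ n ∈ Finset.Icc 1 ⌊v⌋₊, 1 :=
        (Finset.abs_sum_le_sum_abs _ _).trans
          (Finset.sum_le_sum fun n _ => (mul_one (c n)).symm ▸ hc n)
    _ ≤ 1 * ‖v‖ := by simpa [abs_of_nonneg hv₀] using Nat.floor_le hv₀

lemma dsum_comp_mul_sub_isBigO_one {c : ArithmeticFunction ℝ} (hc : ∀ n, |c n| ≤ 1) {P : ℝ → ℝ}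
    (hP : P =O[𝓟 (Ici 1)] fun t => t⁻¹) :
    (fun v => dsum c (fun t => P (v * t)) v - dsum c (fun _ => 1) v * P v) =O[𝓟 (Ici 1)]
      fun _ => (1 : ℝ) :=
  (dsum_comp_mul_isBigO_one hc hP).sub <|
    ((dsum_one_isBigO_id hc).mul hP).congr' EventuallyEq.rfl
      (eventually_principal.mpr fun v (hv : 1 ≤ v) => mul_inv_cancel₀ (by linarith))

lemma dsum_sigmaR_log_mul_self_eq {a c K v : ℝ} {P Q : ℝ → ℝ} (ha : -1 < a) (ha' : a < 0)
    (hP : ∀ t, dsum ArithmeticFunction.zeta Real.log t = t - Real.log t / 2 - c + P t)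
    (hQ : ∀ t, dsum (idPow a) Real.log t =
      1 / (1 + a) ^ 2 * t ^ (1 + a) + zetaR (-a) * Real.log t + K + Q t) (hv : 1 ≤ v) :
    dsum (sigmaR a) Real.log (v * v) =
      zetaR (1 - a) * v ^ 2 + zetaR (1 + a) / (1 + a) ^ 2 * (v ^ (1 + a)) ^ 2 -
        zetaR (-a) * Real.log v +
      (v ^ (2 : ℝ) * powSumErr (1 - a) v +
        1 / (1 + a) ^ 2 * (v ^ (2 * (1 + a)) * powSumErr (1 + a) v) -
        v ^ (1 : ℝ) * powSumErr (-a) v +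
        (dsum (idPow a) (fun t => P (v * t)) v - dsum (idPow a) (fun _ => 1) v * P v) +
        (dsum ArithmeticFunction.zeta (fun t => Q (v * t)) v -
          dsum ArithmeticFunction.zeta (fun _ => 1) v * Q v) -
        1 / 2 * Q v + zetaR (-a) * P v - (K / 2 + zetaR (-a) * c)) := by
  have hone : dsum (idPow a) (fun _ => 1) v = powSum (-a) v := by
    rw [← dsum_idPow_one, neg_neg]
  have hhyperbola := dsum_mul_log (ArithmeticFunction.zeta : ArithmeticFunction ℝ) (idPow a)
    (zero_le_one.trans hv) hv
  simp only [mul_comm _ v] at hhyperbola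
  simp only [sigmaR, hone, dsum_zeta_one] at hhyperbola ⊢
  linear_combination zetaR (-a) * hP v - 1 / 2 * hQ v + hhyperbola +
    dsum_idPow_comp_mul_sub hP a hv + dsum_zeta_comp_mul_sub hQ hv +
    powSum_expansion_collapse ha ha' hv

lemma dsum_sigmaR_log_mul_self_sub_isBigO {a : ℝ} (ha : -1 < a) (ha' : a < 0) :
    (fun v => dsum (sigmaR a) Real.log (v * v) -
      (zetaR (1 - a) * v ^ 2 + zetaR (1 + a) / (1 + a) ^ 2 * (v ^ (1 + a)) ^ 2 -
        zetaR (-a) * Real.log v)) =O[𝓟 (Ici 1)] fun _ => (1 : ℝ) := by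
  obtain ⟨K, hK⟩ := exists_dsum_idPow_log_sub_isBigO (s := -a) (by linarith) (by linarith)
  simp only [neg_neg, sub_neg_eq_add] at hK
  obtain ⟨P, hP, hPO⟩ : ∃ P : ℝ → ℝ, (∀ t, dsum ArithmeticFunction.zeta Real.log t =
      t - Real.log t / 2 - Real.log √(2 * Real.pi) + P t) ∧ P =O[𝓟 (Ici 1)] fun t => t⁻¹ :=
    ⟨_, fun t => (add_sub_cancel _ _).symm, dsum_zeta_log_sub_isBigO⟩
  obtain ⟨Q, hQ, hQO⟩ : ∃ Q : ℝ → ℝ, (∀ t, dsum (idPow a) Real.log t =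
      1 / (1 + a) ^ 2 * t ^ (1 + a) + zetaR (-a) * Real.log t + K + Q t) ∧
      Q =O[𝓟 (Ici 1)] fun t => t⁻¹ :=
    ⟨_, fun t => by ring, hK.trans <| by
      simpa only [Real.rpow_neg_one] using rpow_isBigO_rpow (by linarith : -(-a + 1) ≤ -1)⟩
  have hErr {p s : ℝ} (hs : 0 < s) (hs' : s ≠ 1) (hp : p ≤ s + 1) :
      (fun v => v ^ p * powSumErr s v) =O[𝓟 (Ici 1)] fun _ => (1 : ℝ) :=
    isBigO_rpow_mul_of_isBigO (powSum_sub_isBigO hs hs') (by linarith)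
  have hErr₁ := hErr (s := 1 - a) (p := 2) (by linarith) (by linarith) (by linarith)
  have hErr₂ := hErr (s := 1 + a) (p := 2 * (1 + a)) (by linarith) (by linarith) (by linarith)
  have hErr₃ := hErr (s := -a) (p := 1) (by linarith) (by linarith) (by linarith)
  have hPsum := dsum_comp_mul_sub_isBigO_one (abs_idPow_le_one ha'.le) hPO
  have hQsum := dsum_comp_mul_sub_isBigO_one abs_zeta_le_one hQO
  refine ((((((((hErr₁.add (hErr₂.const_mul_left (1 / (1 + a) ^ 2))).sub hErr₃).add hPsum).add
    hQsum).sub ((hQO.trans inv_isBigO_one).const_mul_left (1 / 2))).add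
    ((hPO.trans inv_isBigO_one).const_mul_left (zetaR (-a)))).sub (isBigO_const_one ℝ
      (K / 2 + zetaR (-a) * Real.log √(2 * Real.pi)) _))).congr'
    (eventually_principal.mpr fun v (hv : 1 ≤ v) => ?_) EventuallyEq.rfl
  exact (sub_eq_of_eq_add' (dsum_sigmaR_log_mul_self_eq ha ha' hP hQ hv)).symm

lemma dsum_sigmaR_log_sub_isBigO {a : ℝ} (ha : -1 < a) (ha' : a < 0) :
    (fun y => dsum (sigmaR a) Real.log y -
      (zetaR (1 - a) * y + zetaR (1 + a) / (1 + a) ^ 2 * y ^ (1 + a) -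
        zetaR (-a) / 2 * Real.log y)) =O[𝓟 (Ici 1)] fun _ => (1 : ℝ) := by
  have hsqrt : Tendsto Real.sqrt (𝓟 (Ici 1)) (𝓟 (Ici 1)) :=
    tendsto_principal_principal.mpr fun y hy => Real.one_le_sqrt.mpr hy
  refine ((dsum_sigmaR_log_mul_self_sub_isBigO ha ha').comp_tendsto hsqrt).congr'
    (eventually_principal.mpr fun y (hy : 1 ≤ y) => ?_) EventuallyEq.rfl
  have hy₀ : 0 ≤ y := zero_le_one.trans hy
  rw [Function.comp_apply, Real.mul_self_sqrt hy₀, Real.sq_sqrt hy₀, ← Real.rpow_mul_natCast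
    (Real.sqrt_nonneg y), mul_comm (1 + a), Real.rpow_natCast_mul (Real.sqrt_nonneg y),
    Real.sq_sqrt hy₀, Real.log_sqrt hy₀]
  ring

/-! ### Remainders of logarithmic size -/

/-- `f(x) = O((1 + log x) ^ k)` uniformly on `[1, ∞)`. The gauge is bounded below there, unlike
`log x ^ k`, so that such bounds can be summed over the arguments `x / n ≥ 1`. -/
abbrev LogBdd (k : ℕ) (f : ℝ → ℝ) : Prop := f =O[𝓟 (Ici 1)] fun x => (1 + Real.log x) ^ k

lemma logBdd_zero_iff {f : ℝ → ℝ} : LogBdd 0 f ↔ f =O[𝓟 (Ici 1)] fun _ => (1 : ℝ) := by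
  simp only [LogBdd, pow_zero]

lemma one_le_one_add_log {x : ℝ} (hx : 1 ≤ x) : 1 ≤ 1 + Real.log x :=
  le_add_of_nonneg_right (Real.log_nonneg hx)

lemma logBdd_one_log : LogBdd 1 Real.log :=
  isBigO_principal.mpr ⟨1, fun x (hx : 1 ≤ x) => by
    have := Real.log_nonneg hx
    rw [pow_one, one_mul, Real.norm_of_nonneg this, Real.norm_of_nonneg (by linarith)]
    linarith⟩

section

variable {k l : ℕ} {f W : ℝ → ℝ} {c : ArithmeticFunction ℝ}

lemma LogBdd.mono (hf : LogBdd k f) (hkl : k ≤ l) : LogBdd l f :=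
  hf.trans (isBigO_principal.mpr ⟨1, fun x (hx : 1 ≤ x) => by
    have hlog := one_le_one_add_log hx
    rw [one_mul, Real.norm_of_nonneg (by positivity), Real.norm_of_nonneg (by positivity)]
    exact pow_le_pow_right₀ hlog hkl⟩)

lemma LogBdd.log_sub_one_mul (hf : LogBdd k f) :
    LogBdd (k + 1) fun x => (Real.log x - 1) * f x := by
  have hlog : LogBdd 1 fun x => Real.log x - 1 :=
    logBdd_one_log.sub ((logBdd_zero_iff.mpr (isBigO_refl _ _)).mono zero_le_one)
  exact (hlog.mul hf).congr_right fun x => by ring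

lemma LogBdd.isBigO_atTop (hf : LogBdd k f) : f =O[atTop] fun x => Real.log x ^ k := by
  refine (IsBigO.mono hf (le_principal_iff.mpr (Ici_mem_atTop 1))).trans (IsBigO.pow ?_ k)
  exact ((Real.isLittleO_const_log_atTop (c := 1)).isBigO).add (isBigO_refl _ _)

lemma logBdd_dsum (hc : LogBdd l fun x => ∑ n ∈ Finset.Icc 1 ⌊x⌋₊, |c n|) (hW : LogBdd k W) :
    LogBdd (l + k) (dsum c W) := by
  obtain ⟨C, hC⟩ := isBigO_principal.mp hW
  have hterm : dsum c W =O[𝓟 (Ici 1)] fun x =>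
      (∑ n ∈ Finset.Icc 1 ⌊x⌋₊, |c n|) * (1 + Real.log x) ^ k :=
    isBigO_principal.mpr ⟨C, fun x (hx : 1 ≤ x) => by
      have hC₀ : 0 ≤ C := by simpa using (norm_nonneg _).trans (hC 1 (mem_Ici.mpr le_rfl))
      have hlog := Real.log_nonneg hx
      rw [norm_mul, Real.norm_of_nonneg (Finset.sum_nonneg fun _ _ => abs_nonneg _),
        Real.norm_of_nonneg (pow_nonneg (by positivity) k), mul_left_comm, Finset.sum_mul,
        Real.norm_eq_abs]
      refine (Finset.abs_sum_le_sum_abs _ _).trans (Finset.sum_le_sum fun n hn => ?_)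
      have hxn := one_le_div_of_mem_Icc_floor hn
      have hn₁ : (1 : ℝ) ≤ n := by exact_mod_cast (Finset.mem_Icc.mp hn).1
      have hlog' := one_le_one_add_log hxn
      rw [abs_mul]
      refine mul_le_mul_of_nonneg_left ((hC _ hxn).trans ?_) (abs_nonneg _)
      rw [Real.norm_of_nonneg (by positivity)]
      gcongr
      exact div_le_self (by linarith) hn₁⟩
  exact (hterm.trans (hc.mul (isBigO_refl _ _))).congr_right fun x => (pow_add _ l k).symm

lemma logBdd_dsum_log (hc : LogBdd k (dsum c fun _ => 1)) : LogBdd (k + 1) (dsum c Real.log) := by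
  obtain ⟨C, hC⟩ := isBigO_principal.mp hc
  refine isBigO_principal.mpr ⟨C, fun x (hx : 1 ≤ x) => ?_⟩
  have hC₀ : 0 ≤ C := by simpa using (norm_nonneg _).trans (hC 1 (mem_Ici.mpr le_rfl))
  have hlog := Real.log_nonneg hx
  rw [dsum_log_eq_integral _ hx,
    Real.norm_of_nonneg (by positivity : 0 ≤ (1 + Real.log x) ^ (k + 1))]
  calc ‖∫ u in (1 : ℝ)..x, u⁻¹ * dsum c (fun _ => 1) u‖
      ≤ ∫ u in (1 : ℝ)..x, u⁻¹ * (C * (1 + Real.log x) ^ k) := by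
        refine intervalIntegral.norm_integral_le_of_norm_le hx (ae_of_all _ fun u hu => ?_) ?_
        · have hu₀ : 0 < u := one_pos.trans hu.1
          have hlog' := one_le_one_add_log hu.1.le
          rw [norm_mul, Real.norm_of_nonneg (inv_pos.mpr hu₀).le]
          refine mul_le_mul_of_nonneg_left ((hC u hu.1.le).trans ?_) (inv_pos.mpr hu₀).le
          rw [Real.norm_of_nonneg (by positivity)]
          gcongr
          exact hu.2
        · refine (intervalIntegral.intervalIntegrable_inv (fun u hu => ?_)
            continuousOn_id).mul_const _
          rw [uIcc_of_le hx] at hu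
          exact (one_pos.trans_le hu.1).ne'
    _ = Real.log x * (C * (1 + Real.log x) ^ k) := by
        rw [intervalIntegral.integral_mul_const, integral_inv_of_pos one_pos (by linarith), div_one]
    _ ≤ (1 + Real.log x) * (C * (1 + Real.log x) ^ k) := by gcongr; linarith
    _ = C * (1 + Real.log x) ^ (k + 1) := by ring

end

/-! ### Tails of Dirichlet series -/

lemma abs_sum_sub_le_of_hasSum {ι : Type*} {c b : ι → ℝ} {Z B : ℝ} (hc : HasSum c Z)
    (hb : HasSum b B) (F : Finset ι) (h : ∀ i ∉ F, |c i| ≤ b i) :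
    |∑ i ∈ F, c i - Z| ≤ B - ∑ i ∈ F, b i := by
  have hc' : HasSum (fun i : {i // i ∉ F} => c i) (Z - ∑ i ∈ F, c i) :=
    F.hasSum_compl_iff.mpr (by rwa [sub_add_cancel])
  have hb' : HasSum (fun i : {i // i ∉ F} => b i) (B - ∑ i ∈ F, b i) :=
    F.hasSum_compl_iff.mpr (by rwa [sub_add_cancel])
  rw [abs_sub_comm, ← hc'.tsum_eq, ← Real.norm_eq_abs]
  exact tsum_of_norm_bounded hb' fun i => h i i.2

lemma powSumRem_isBigO {s : ℝ} (hs : 0 < s) (hs' : s ≠ 1) :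
    powSumRem s =O[𝓟 (Ici 1)] fun t => t ^ (-s) := by
  have hsaw : (fun t => sawtooth t * t ^ (-s)) =O[𝓟 (Ici 1)] fun t => t ^ (-s) :=
    isBigO_principal.mpr ⟨1 / 2, fun t _ => by
      rw [norm_mul]
      exact mul_le_mul_of_nonneg_right (abs_sawtooth_le t) (norm_nonneg _)⟩
  refine (((powSum_sub_isBigO hs hs').trans
    (rpow_isBigO_rpow (by linarith))).sub hsaw).congr_left fun t => ?_
  rw [powSumRem]
  ring

lemma zetaR_sub_powSum_isBigO {s : ℝ} (hs : 0 < s) :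
    (fun t => zetaR (1 + s) - powSum (1 + s) t) =O[𝓟 (Ici 1)] fun t => t ^ (-s) := by
  refine ((((powSumRem_isBigO (s := 1 + s) (by linarith) (by linarith)).trans
    (rpow_isBigO_rpow (by linarith))).neg_left).add
    ((isBigO_refl (fun t : ℝ => t ^ (-s)) _).const_mul_left (1 / s))).congr_left fun t => ?_
  rw [powSumRem, sub_add_cancel_left]
  field_simp
  ring

section

variable {c : ArithmeticFunction ℝ} {s Z : ℝ}

lemma logBdd_dsum_rpow_sub_of_tail {k : ℕ}
    (htail : (fun x => ∑ n ∈ Finset.Icc 1 ⌊x⌋₊, c n * (n : ℝ) ^ (-s) - Z) =O[𝓟 (Ici 1)]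
      fun x => x ^ (-s) * (1 + Real.log x) ^ k) :
    LogBdd k fun x => dsum c (fun y => y ^ s) x - Z * x ^ s :=
  ((isBigO_refl (fun x : ℝ => x ^ s) _).mul htail).congr'
    (eventually_principal.mpr fun x (hx : 1 ≤ x) => by
      simp only [dsum_rpow c s (zero_le_one.trans hx)]
      ring)
    (eventually_principal.mpr fun x (hx : 1 ≤ x) => by
      have hx₀ : 0 < x := one_pos.trans_le hx
      simp only [← mul_assoc, ← Real.rpow_add hx₀, add_neg_cancel, Real.rpow_zero, one_mul])

lemma logBdd_zero_dsum_rpow_sub (hs : 0 < s) (hc : ∀ n : ℕ, |c n| ≤ (n : ℝ)⁻¹)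
    (hZ : HasSum (fun n : ℕ => c n * (n : ℝ) ^ (-s)) Z) :
    LogBdd 0 fun x => dsum c (fun y => y ^ s) x - Z * x ^ s := by
  have hterm (n : ℕ) : |c n * (n : ℝ) ^ (-s)| ≤ (n : ℝ) ^ (-(1 + s)) := by
    rcases eq_or_ne n 0 with rfl | hn
    · simp [Real.zero_rpow (by linarith : -(1 + s) ≠ 0), -neg_add_rev]
    have hn₀ : (0 : ℝ) < n := by positivity
    rw [neg_add, Real.rpow_add hn₀, Real.rpow_neg_one, abs_mul,
      abs_of_nonneg (by positivity : 0 ≤ (n : ℝ) ^ (-s))]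
    exact mul_le_mul_of_nonneg_right (hc n) (by positivity)
  refine logBdd_dsum_rpow_sub_of_tail ((isBigO_principal.mpr ⟨1, fun x _ => ?_⟩).trans
    ((zetaR_sub_powSum_isBigO hs).congr_right fun x => by rw [pow_zero, mul_one]))
  rw [one_mul]
  exact (abs_sum_sub_le_of_hasSum hZ (hasSum_zetaR (by linarith)) _ fun n _ => hterm n).trans
    (le_abs_self _)

lemma log_mul_rpow_le {ε t x : ℝ} (hε : 0 < ε) (ht : 0 < t) (hx : 0 < x) (p : ℝ) :
    Real.log t * t ^ (-p) ≤ Real.log x * t ^ (-p) + x ^ (-ε) / ε * t ^ (-(p - ε)) := by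
  have hlog : Real.log t - Real.log x ≤ (t / x) ^ ε / ε := by
    rw [← Real.log_div ht.ne' hx.ne']
    exact Real.log_le_rpow_div (by positivity) hε
  calc Real.log t * t ^ (-p) ≤ (Real.log x + (t / x) ^ ε / ε) * t ^ (-p) := by
        gcongr
        linarith
    _ = Real.log x * t ^ (-p) + x ^ (-ε) / ε * t ^ (-(p - ε)) := by
        rw [Real.div_rpow ht.le hx.le, Real.rpow_neg hx.le, neg_sub, sub_eq_add_neg,
          Real.rpow_add ht]
        ring

lemma abs_mul_rpow_le_of_abs_le_log_div (hc : ∀ n : ℕ, |c n| ≤ Real.log n / n) {ε x : ℝ}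
    (hε : 0 < ε) (hx : 1 ≤ x) (n : ℕ) :
    |c n * (n : ℝ) ^ (-s)| ≤
      Real.log x * (n : ℝ) ^ (-(1 + s)) + x ^ (-ε) / ε * (n : ℝ) ^ (-(1 + (s - ε))) := by
  have hlog := Real.log_nonneg hx
  rcases eq_or_ne n 0 with rfl | hn
  · rw [ArithmeticFunction.map_zero, zero_mul, abs_zero]
    positivity
  have hn₀ : (0 : ℝ) < n := by positivity
  calc |c n * (n : ℝ) ^ (-s)| ≤ Real.log n / n * (n : ℝ) ^ (-s) := by
        rw [abs_mul, abs_of_nonneg (by positivity : 0 ≤ (n : ℝ) ^ (-s))]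
        exact mul_le_mul_of_nonneg_right (hc n) (by positivity)
    _ = Real.log n * (n : ℝ) ^ (-(1 + s)) := by
        rw [neg_add, Real.rpow_add hn₀, Real.rpow_neg_one]
        ring
    _ ≤ _ := by
        rw [← add_sub_assoc]
        exact log_mul_rpow_le hε hn₀ (one_pos.trans_le hx) (1 + s)

lemma logBdd_one_dsum_rpow_sub (hs : 0 < s) (hc : ∀ n : ℕ, |c n| ≤ Real.log n / n)
    (hZ : HasSum (fun n : ℕ => c n * (n : ℝ) ^ (-s)) Z) :
    LogBdd 1 fun x => dsum c (fun y => y ^ s) x - Z * x ^ s := by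
  have hs₂ : 0 < s / 2 := half_pos hs
  refine logBdd_dsum_rpow_sub_of_tail (IsBigO.trans (g := fun x =>
    Real.log x * (zetaR (1 + s) - powSum (1 + s) x) +
      x ^ (-(s / 2)) / (s / 2) * (zetaR (1 + s / 2) - powSum (1 + s / 2) x))
    (isBigO_principal.mpr ⟨1, fun x (hx : 1 ≤ x) => ?_⟩) (.add ?_ ?_))
  · rw [one_mul]
    refine (abs_sum_sub_le_of_hasSum hZ (((hasSum_zetaR (by linarith)).mul_left _).add
      ((hasSum_zetaR (by linarith)).mul_left _)) _
      fun n _ => abs_mul_rpow_le_of_abs_le_log_div hc hs₂ hx n).trans ((le_abs_self _).trans_eq ?_)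
    rw [Finset.sum_add_distrib, ← Finset.mul_sum, ← Finset.mul_sum, Real.norm_eq_abs, powSum,
      powSum, sub_half]
    ring_nf
  · refine (logBdd_one_log.mul (zetaR_sub_powSum_isBigO hs)).congr_right fun x => by ring
  · refine IsBigO.trans (g := fun x => x ^ (-s)) ?_ ?_
    · refine (((isBigO_refl (fun x : ℝ => x ^ (-(s / 2))) _).const_mul_left (s / 2)⁻¹).mul
        (zetaR_sub_powSum_isBigO hs₂)).congr'
        (.of_eq (by ext x; ring)) (eventually_principal.mpr fun x (hx : 1 ≤ x) => ?_)
      simp only [← Real.rpow_add (one_pos.trans_le hx), ← neg_add, add_halves]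
    · exact ((isBigO_refl (fun x : ℝ => x ^ (-s)) _).mul
        ((logBdd_zero_iff.mpr (isBigO_refl _ _)).mono zero_le_one)).congr_left fun x => mul_one _

end

/-! ### Twists by the Möbius function -/

/-- The arithmetical function `n ↦ c(n) / n`; the map `c ↦ divId c` respects convolution. -/
def divId (c : ArithmeticFunction ℝ) : ArithmeticFunction ℝ :=
  ⟨fun n => c n / n, by rw [ArithmeticFunction.map_zero, zero_div]⟩

lemma divId_apply (c : ArithmeticFunction ℝ) (n : ℕ) : divId c n = c n / n := rfl

lemma divId_mul (c d : ArithmeticFunction ℝ) : divId (c * d) = divId c * divId d := by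
  ext n
  rw [divId_apply, ArithmeticFunction.mul_apply, ArithmeticFunction.mul_apply, Finset.sum_div]
  refine Finset.sum_congr rfl fun p hp => ?_
  rw [← (Nat.mem_divisorsAntidiagonal.mp hp).1, divId_apply, divId_apply, Nat.cast_mul,
    mul_div_mul_comm]

lemma divId_one : divId 1 = 1 := by
  ext n
  rcases eq_or_ne n 1 with rfl | hn
  · rw [divId_apply, Nat.cast_one, div_one]
  · rw [divId_apply, ArithmeticFunction.one_apply_ne hn, zero_div]

lemma divId_idPow (a : ℝ) : divId (idPow (1 + a)) = idPow a := by
  ext n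
  rcases eq_or_ne n 0 with rfl | hn
  · simp
  · rw [divId_apply, idPow_apply hn, idPow_apply hn, add_comm 1 a,
      Real.rpow_add_one (by exact_mod_cast hn), mul_div_cancel_right₀ _ (by exact_mod_cast hn)]

lemma divId_mul_rpow (c : ArithmeticFunction ℝ) (n : ℕ) (s : ℝ) :
    divId c n * (n : ℝ) ^ (-s) = c n * (n : ℝ) ^ (-(1 + s)) := by
  rcases eq_or_ne n 0 with rfl | hn
  · simp
  · rw [divId_apply, neg_add, Real.rpow_add (by positivity), Real.rpow_neg_one]
    ring

lemma dsum_id (c : ArithmeticFunction ℝ) (x : ℝ) :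
    dsum c (fun y => y) x = x * dsum (divId c) (fun _ => 1) x := by
  rw [dsum, dsum, Finset.mul_sum]
  refine Finset.sum_congr rfl fun n _ => ?_
  rw [divId_apply]
  ring

lemma abs_moebiusR_le_one (n : ℕ) : |moebiusR n| ≤ 1 := by
  rw [moebiusR, ArithmeticFunction.intCoe_apply]
  exact_mod_cast ArithmeticFunction.abs_moebius_le_one

lemma moebiusR_mul_zeta : moebiusR * (ArithmeticFunction.zeta : ArithmeticFunction ℝ) = 1 := by
  rw [moebiusR]
  exact ArithmeticFunction.coe_moebius_mul_coe_zeta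

lemma dsum_one (W : ℝ → ℝ) {x : ℝ} (hx : 1 ≤ x) : dsum 1 W x = W x := by
  rw [dsum, Finset.sum_eq_single_of_mem 1
    (Finset.mem_Icc.mpr ⟨le_rfl, (Nat.one_le_floor_iff x).mpr hx⟩)
    fun n _ hn => by rw [ArithmeticFunction.one_apply_ne hn, zero_mul],
    ArithmeticFunction.one_one, one_mul, Nat.cast_one, div_one]

lemma abs_divId_moebiusR_le (n : ℕ) : |divId moebiusR n| ≤ (n : ℝ)⁻¹ := by
  rw [divId_apply, abs_div, Nat.abs_cast, div_eq_mul_inv]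
  exact mul_le_of_le_one_left (by positivity) (abs_moebiusR_le_one n)

lemma logBdd_one_sum_abs_divId_moebiusR :
    LogBdd 1 fun x => ∑ n ∈ Finset.Icc 1 ⌊x⌋₊, |divId moebiusR n| :=
  isBigO_principal.mpr ⟨1, fun x (hx : 1 ≤ x) => by
    have hharm := harmonic_floor_le_one_add_log x hx
    rw [harmonic_eq_sum_Icc] at hharm
    push_cast at hharm
    rw [one_mul, pow_one, Real.norm_of_nonneg (Finset.sum_nonneg fun _ _ => abs_nonneg _)]
    exact (Finset.sum_le_sum fun n _ => abs_divId_moebiusR_le n).trans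
      (hharm.trans (le_abs_self _))⟩

-- `∑_{n ≤ x} μ(n) ⌊x / n⌋ = 1`, and replacing each floor by `x / n` costs less than `x` in total.
lemma logBdd_zero_dsum_divId_moebiusR_one : LogBdd 0 (dsum (divId moebiusR) fun _ => 1) := by
  refine logBdd_zero_iff.mpr (isBigO_principal.mpr ⟨2, fun x (hx : 1 ≤ x) => ?_⟩)
  have hx₀ : 0 < x := one_pos.trans_le hx
  have hfloor : dsum moebiusR (fun y => (⌊y⌋₊ : ℝ)) x = 1 := by
    simp only [← dsum_zeta_one]
    rw [← dsum_mul, moebiusR_mul_zeta, dsum_one _ hx]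
  have hdiff : |dsum moebiusR (fun y => y - ⌊y⌋₊) x| ≤ x :=
    calc |dsum moebiusR (fun y => y - ⌊y⌋₊) x| ≤ ∑ n ∈ Finset.Icc 1 ⌊x⌋₊, 1 := by
          refine (Finset.abs_sum_le_sum_abs _ _).trans (Finset.sum_le_sum fun n _ => ?_)
          rw [abs_mul]
          refine mul_le_one₀ (abs_moebiusR_le_one n) (abs_nonneg _) (abs_le.mpr ?_)
          have := Nat.floor_le (div_nonneg hx₀.le (Nat.cast_nonneg n))
          have := Nat.lt_floor_add_one (x / n)
          constructor <;> linarith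
      _ = ⌊x⌋₊ := by simp
      _ ≤ x := Nat.floor_le hx₀.le
  rw [dsum_sub, hfloor, dsum_id] at hdiff
  refine le_of_mul_le_mul_left ?_ hx₀
  rw [norm_one, Real.norm_eq_abs, ← abs_of_pos hx₀, ← abs_mul, abs_of_pos hx₀, abs_le]
  rw [abs_le] at hdiff
  constructor <;> linarith

lemma logBdd_one_dsum_divId_moebiusR_log : LogBdd 1 (dsum (divId moebiusR) Real.log) :=
  logBdd_dsum_log logBdd_zero_dsum_divId_moebiusR_one

lemma logBdd_zero_dsum_divId_moebiusR_rpow {s : ℝ} (hs : 0 < s) :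
    LogBdd 0 fun x => dsum (divId moebiusR) (fun y => y ^ s) x - 1 / zetaR (1 + s) * x ^ s := by
  refine logBdd_zero_dsum_rpow_sub hs abs_divId_moebiusR_le ?_
  simpa only [divId_mul_rpow] using hasSum_moebius (s := 1 + s) (by linarith)

lemma logBdd_dsum_divId_moebiusR_expansion {k : ℕ} {s α β : ℝ} (hs : 0 < s) {V D : ℝ → ℝ}
    (hV : LogBdd k fun y => V y - (α * y + β * y ^ s + D y)) :
    LogBdd (1 + k) fun x => dsum (divId moebiusR) V x -
      (α / zetaR 2 * x + β / zetaR (1 + s) * x ^ s + dsum (divId moebiusR) D x) := by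
  have hid := logBdd_zero_dsum_divId_moebiusR_rpow one_pos
  simp only [Real.rpow_one, one_add_one_eq_two] at hid
  have hlin := (hid.const_mul_left α).add
    ((logBdd_zero_dsum_divId_moebiusR_rpow hs).const_mul_left β)
  refine ((logBdd_dsum logBdd_one_sum_abs_divId_moebiusR hV).add
    (LogBdd.mono hlin (Nat.zero_le _))).congr_left fun x => ?_
  rw [dsum_sub, dsum_add, dsum_add, dsum_const_mul, dsum_const_mul]
  ring

section

variable {a : ℝ}

lemma logBdd_zero_dsum_idPow_one_sub (ha : -1 < a) (ha' : a < 0) :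
    LogBdd 0 fun y => dsum (idPow a) (fun _ => 1) y - 1 / (1 + a) * y ^ (1 + a) := by
  have hone : (fun _ => zetaR (-a)) =O[𝓟 (Ici 1)] fun _ : ℝ => (1 : ℝ) :=
    isBigO_const_const _ one_ne_zero _
  have hrem := (powSumRem_isBigO (s := -a) (by linarith) (by linarith)).trans
    (rpow_isBigO_rpow (q := 0) (by linarith))
  simp only [Real.rpow_zero] at hrem
  refine logBdd_zero_iff.mpr ((hrem.add hone).congr_left fun y => ?_)
  rw [powSumRem, ← dsum_idPow_one, neg_neg, sub_neg_eq_add]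
  ring

lemma logBdd_dsum_dsum_idPow_one_sub (ha : -1 < a) (ha' : a < 0) {c : ArithmeticFunction ℝ}
    {k : ℕ} {Z : ℝ} (hc : LogBdd k fun x => ∑ n ∈ Finset.Icc 1 ⌊x⌋₊, |c n|)
    (hZ : LogBdd k fun x => dsum c (fun y => y ^ (1 + a)) x - Z * x ^ (1 + a)) :
    LogBdd k fun x => dsum c (dsum (idPow a) fun _ => 1) x - Z / (1 + a) * x ^ (1 + a) := by
  refine ((logBdd_dsum hc (logBdd_zero_dsum_idPow_one_sub ha ha')).add
    (hZ.const_mul_left (1 / (1 + a)))).congr_left fun x => ?_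
  rw [dsum_sub, dsum_const_mul]
  ring

lemma sum_log_le_mul_log {x : ℝ} (hx : 1 ≤ x) :
    ∑ n ∈ Finset.Icc 1 ⌊x⌋₊, Real.log n ≤ x * Real.log x :=
  calc ∑ n ∈ Finset.Icc 1 ⌊x⌋₊, Real.log n ≤ ∑ _n ∈ Finset.Icc 1 ⌊x⌋₊, Real.log x :=
        Finset.sum_le_sum fun n hn => by
          obtain ⟨hn₁, hn₂⟩ := Finset.mem_Icc.mp hn
          exact Real.log_le_log (by exact_mod_cast hn₁) ((Nat.le_floor_iff' (by lia)).mp hn₂)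
    _ = ⌊x⌋₊ * Real.log x := by simp
    _ ≤ x * Real.log x :=
        mul_le_mul_of_nonneg_right (Nat.floor_le (by linarith)) (Real.log_nonneg hx)

lemma dsum_divId_vonMangoldt_one_le {x : ℝ} (hx : 1 ≤ x) :
    dsum (divId ArithmeticFunction.vonMangoldt) (fun _ => 1) x ≤ 2 * Real.log x := by
  have hlog : dsum ArithmeticFunction.vonMangoldt (fun y => (⌊y⌋₊ : ℝ)) x =
      ∑ n ∈ Finset.Icc 1 ⌊x⌋₊, Real.log n := by
    simp only [← dsum_zeta_one]
    rw [← dsum_mul, ArithmeticFunction.vonMangoldt_mul_zeta]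
    simp only [dsum, mul_one, ArithmeticFunction.log_apply]
  have hle : dsum ArithmeticFunction.vonMangoldt (fun y => y) x ≤
      dsum ArithmeticFunction.vonMangoldt (fun y => 2 * ⌊y⌋₊) x :=
    Finset.sum_le_sum fun n hn => by
      have hfloor : (1 : ℝ) ≤ ⌊x / n⌋₊ := by
        exact_mod_cast (Nat.one_le_floor_iff _).mpr (one_le_div_of_mem_Icc_floor hn)
      have := Nat.lt_floor_add_one (x / n)
      exact mul_le_mul_of_nonneg_left (by linarith) ArithmeticFunction.vonMangoldt_nonneg
  rw [dsum_const_mul, hlog, dsum_id] at hle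
  refine le_of_mul_le_mul_left (hle.trans ?_) (one_pos.trans_le hx)
  linarith [sum_log_le_mul_log hx]

lemma logBdd_one_sum_abs_divId_vonMangoldt :
    LogBdd 1 fun x => ∑ n ∈ Finset.Icc 1 ⌊x⌋₊, |divId ArithmeticFunction.vonMangoldt n| := by
  have habs (n : ℕ) : |divId ArithmeticFunction.vonMangoldt n| =
      divId ArithmeticFunction.vonMangoldt n * 1 := by
    rw [mul_one, divId_apply, abs_of_nonneg
      (div_nonneg ArithmeticFunction.vonMangoldt_nonneg (Nat.cast_nonneg n))]
  refine IsBigO.trans (isBigO_principal.mpr ⟨2, fun x (hx : 1 ≤ x) => ?_⟩) logBdd_one_log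
  rw [Real.norm_of_nonneg (Finset.sum_nonneg fun _ _ => abs_nonneg _),
    Real.norm_of_nonneg (Real.log_nonneg hx)]
  simp only [habs]
  exact dsum_divId_vonMangoldt_one_le hx

lemma logBdd_one_dsum_divId_vonMangoldt_idPow (ha : -1 < a) (ha' : a < 0) :
    LogBdd 1 fun x => dsum (divId ArithmeticFunction.vonMangoldt) (dsum (idPow a) fun _ => 1) x -
      -zetaR' (2 + a) / zetaR (2 + a) / (1 + a) * x ^ (1 + a) := by
  refine logBdd_dsum_dsum_idPow_one_sub ha ha' logBdd_one_sum_abs_divId_vonMangoldt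
    (logBdd_one_dsum_rpow_sub (by linarith) (fun n => ?_) ?_)
  · rw [divId_apply, abs_of_nonneg
      (div_nonneg ArithmeticFunction.vonMangoldt_nonneg (Nat.cast_nonneg n))]
    gcongr
    exact ArithmeticFunction.vonMangoldt_le_log
  · simp only [divId_mul_rpow, ← add_assoc, one_add_one_eq_two]
    exact hasSum_vonMangoldt (by linarith)

/-- The arithmetical function `l ↦ r(l) / l`, where `r` is the remainder in Stirling's formula. -/
def stirlingArith : ArithmeticFunction ℝ :=
  ⟨fun l => stirlingRem l / l, by rw [Nat.cast_zero, div_zero]⟩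

lemma stirlingArith_apply (l : ℕ) : stirlingArith l = stirlingRem l / l := rfl

lemma abs_stirlingArith_le (l : ℕ) : |stirlingArith l| ≤ (l : ℝ) ^ (-2 : ℝ) := by
  rcases eq_or_ne l 0 with rfl | hl
  · simp
  have hl₁ : 1 ≤ l := Nat.one_le_iff_ne_zero.mpr hl
  have hl₀ : (0 : ℝ) < l := by exact_mod_cast hl₁
  rw [stirlingArith_apply, abs_of_pos (div_pos (stirlingRem_pos hl₁) hl₀)]
  calc stirlingRem l / l ≤ 1 / (12 * l) / l := by
        gcongr
        exact stirlingRem_le hl₁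
    _ ≤ 1 / l / l := by
        gcongr
        linarith
    _ = (l : ℝ) ^ (-2 : ℝ) := by
        rw [Real.rpow_neg hl₀.le, Real.rpow_two]
        field_simp

lemma logBdd_zero_sum_abs_stirlingArith :
    LogBdd 0 fun x => ∑ l ∈ Finset.Icc 1 ⌊x⌋₊, |stirlingArith l| :=
  logBdd_zero_iff.mpr (isBigO_principal.mpr ⟨zetaR 2, fun x _ => by
    rw [norm_one, mul_one, Real.norm_of_nonneg (Finset.sum_nonneg fun _ _ => abs_nonneg _)]
    exact (Finset.sum_le_sum fun l _ => abs_stirlingArith_le l).trans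
      (sum_le_hasSum _ (fun l _ => by positivity) (hasSum_zetaR one_lt_two))⟩)

lemma hasSum_stirlingArith {Z : ℝ}
    (hZ : HasSum (fun l : ℕ => stirlingRem (l + 1) / ((l + 1 : ℕ) : ℝ) ^ (2 + a)) Z) :
    HasSum (fun l : ℕ => stirlingArith l * (l : ℝ) ^ (-(1 + a))) Z := by
  refine (hasSum_nat_add_iff' 1).mp ?_
  rw [Finset.sum_range_one, ArithmeticFunction.map_zero, zero_mul, sub_zero]
  refine hZ.congr_fun fun l => ?_
  have hl : (0 : ℝ) < ((l + 1 : ℕ) : ℝ) := by positivity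
  rw [stirlingArith_apply, Real.rpow_neg hl.le, show 2 + a = 1 + (1 + a) by ring,
    Real.rpow_add hl 1 (1 + a), Real.rpow_one]
  field_simp

lemma logBdd_zero_dsum_stirlingArith_idPow (ha : -1 < a) (ha' : a < 0) {Z : ℝ}
    (hZ : HasSum (fun l : ℕ => stirlingRem (l + 1) / ((l + 1 : ℕ) : ℝ) ^ (2 + a)) Z) :
    LogBdd 0 fun x => dsum stirlingArith (dsum (idPow a) fun _ => 1) x -
      Z / (1 + a) * x ^ (1 + a) := by
  refine logBdd_dsum_dsum_idPow_one_sub ha ha' logBdd_zero_sum_abs_stirlingArith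
    (logBdd_zero_dsum_rpow_sub (by linarith) (fun l => ?_) (hasSum_stirlingArith hZ))
  refine (abs_stirlingArith_le l).trans ?_
  rcases eq_or_ne l 0 with rfl | hl
  · simp
  · rw [← Real.rpow_neg_one]
    exact Real.rpow_le_rpow_of_exponent_le (by exact_mod_cast Nat.one_le_iff_ne_zero.mpr hl)
      (by norm_num)

end

/-! ### Decomposition of the gcd sum -/

lemma dsum_coeff_add (c d : ArithmeticFunction ℝ) (W : ℝ → ℝ) (x : ℝ) :
    dsum (c + d) W x = dsum c W x + dsum d W x := by
  simp only [dsum, ArithmeticFunction.add_apply, add_mul, Finset.sum_add_distrib]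

lemma dsum_coeff_smul (r : ℝ) (c : ArithmeticFunction ℝ) (W : ℝ → ℝ) (x : ℝ) :
    dsum (r • c) W x = r * dsum c W x := by
  simp only [dsum, ArithmeticFunction.smul_map, smul_eq_mul, mul_assoc, Finset.mul_sum]

/-- The arithmetical function by which `log l! / l` exceeds `log l - 1`. -/
def stirlingTail : ArithmeticFunction ℝ :=
  (1 / 2 : ℝ) • divId ArithmeticFunction.log +
    Real.log √(2 * Real.pi) • divId (ArithmeticFunction.zeta : ArithmeticFunction ℝ) +
    stirlingArith

lemma log_factorial_div {l : ℕ} (hl : l ≠ 0) :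
    Real.log l.factorial / l = Real.log l - 1 + stirlingTail l := by
  have hl₀ : (l : ℝ) ≠ 0 := by exact_mod_cast hl
  simp only [stirlingTail, ArithmeticFunction.add_apply, ArithmeticFunction.smul_map, smul_eq_mul,
    divId_apply, stirlingArith_apply, stirlingRem, ArithmeticFunction.log_apply,
    ArithmeticFunction.natCoe_apply, ArithmeticFunction.zeta_apply_ne hl, Nat.cast_one]
  field_simp
  ring

lemma sum_filter_dvd_Icc_mul {d : ℕ} (hd : d ≠ 0) (e : ℕ) (φ : ℕ → ℝ) :
    ∑ j ∈ Finset.Icc 1 (d * e) with d ∣ j, φ j = ∑ m ∈ Finset.Icc 1 e, φ (d * m) := by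
  have hd₀ : 0 < d := Nat.pos_of_ne_zero hd
  have hmult : {j ∈ Finset.Icc 1 (d * e) | d ∣ j} = (Finset.Icc 1 e).image (d * ·) := by
    ext j
    simp only [Finset.mem_filter, Finset.mem_Icc, Finset.mem_image]
    constructor
    · rintro ⟨⟨hj, hje⟩, m, rfl⟩
      exact ⟨m, ⟨Nat.pos_of_mul_pos_left hj, Nat.le_of_mul_le_mul_left hje hd₀⟩, rfl⟩
    · rintro ⟨m, ⟨hm, hme⟩, rfl⟩
      exact ⟨⟨Nat.mul_pos hd₀ hm, Nat.mul_le_mul_left d hme⟩, dvd_mul_right d m⟩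
  rw [hmult, Finset.sum_image fun m _ n _ h => Nat.eq_of_mul_eq_mul_left hd₀ h]

lemma sum_mul_zeta_gcd (g : ArithmeticFunction ℝ) (φ : ℕ → ℝ) {k : ℕ} (hk : k ≠ 0) :
    ∑ j ∈ Finset.Icc 1 k,
        (g * (ArithmeticFunction.zeta : ArithmeticFunction ℝ)) (k.gcd j) * φ j =
      ∑ p ∈ k.divisorsAntidiagonal, g p.1 * ∑ m ∈ Finset.Icc 1 p.2, φ (p.1 * m) := by
  have hdiv (j : ℕ) : (k.gcd j).divisors = {d ∈ k.divisors | d ∣ j} := by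
    ext d
    have hgcd := Nat.gcd_ne_zero_left (n := j) hk
    rw [Finset.mem_filter, Nat.mem_divisors, Nat.mem_divisors, Nat.dvd_gcd_iff]
    tauto
  simp only [ArithmeticFunction.coe_mul_zeta_apply, hdiv, Finset.sum_mul, Finset.sum_filter,
    ite_mul, zero_mul]
  rw [Finset.sum_comm,
    Nat.sum_divisorsAntidiagonal fun d e => g d * ∑ m ∈ Finset.Icc 1 e, φ (d * m)]
  refine Finset.sum_congr rfl fun d hd => ?_
  obtain ⟨hdk, -⟩ := Nat.mem_divisors.mp hd
  rw [← Finset.sum_filter, ← Finset.mul_sum,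
    ← sum_filter_dvd_Icc_mul (ne_zero_of_dvd_ne_zero hk hdk), Nat.mul_div_cancel' hdk]

lemma sum_log_mul {d : ℕ} (hd : d ≠ 0) (e : ℕ) :
    ∑ m ∈ Finset.Icc 1 e, Real.log ((d * m : ℕ) : ℝ) =
      e * Real.log d + Real.log e.factorial := by
  have hlog : ∀ m ∈ Finset.Icc 1 e, Real.log ((d * m : ℕ) : ℝ) = Real.log d + Real.log m :=
    fun m hm => by
      rw [Nat.cast_mul, Real.log_mul (by exact_mod_cast hd)
        (by exact_mod_cast Nat.one_le_iff_ne_zero.mp (Finset.mem_Icc.mp hm).1)]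
  rw [Finset.sum_congr rfl hlog, Finset.sum_add_distrib, Finset.sum_const, Nat.card_Icc,
    Nat.add_sub_cancel, nsmul_eq_mul, sum_log_eq_log_factorial]

lemma one_div_mul_sum_mul_zeta_gcd_log (g : ArithmeticFunction ℝ) {k : ℕ} (hk : k ≠ 0) :
    1 / (k : ℝ) * ∑ j ∈ Finset.Icc 1 k,
        (g * (ArithmeticFunction.zeta : ArithmeticFunction ℝ)) (k.gcd j) * Real.log j =
      (divId g * (ArithmeticFunction.zeta : ArithmeticFunction ℝ)) k * (Real.log k - 1) +
        (divId g * stirlingTail) k := by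
  rw [sum_mul_zeta_gcd g _ hk, ArithmeticFunction.mul_apply, ArithmeticFunction.mul_apply,
    Finset.sum_mul, ← Finset.sum_add_distrib, Finset.mul_sum]
  refine Finset.sum_congr rfl fun p hp => ?_
  have hpk := (Nat.mem_divisorsAntidiagonal.mp hp).1
  obtain ⟨hd, he⟩ := mul_ne_zero_iff.mp (hpk.trans_ne hk)
  have hd₀ : (p.1 : ℝ) ≠ 0 := by exact_mod_cast hd
  have he₀ : (p.2 : ℝ) ≠ 0 := by exact_mod_cast he
  have hfact := (div_eq_iff he₀).mp (log_factorial_div he)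
  rw [sum_log_mul hd, hfact, ← hpk, Nat.cast_mul, Real.log_mul hd₀ he₀, divId_apply,
    ArithmeticFunction.natCoe_apply, ArithmeticFunction.zeta_apply_ne he, Nat.cast_one]
  field_simp
  ring

lemma logGcdSum_mul_zeta (g : ArithmeticFunction ℝ) {x : ℝ} (hx : x ≠ 0) :
    logGcdSum x (g * (ArithmeticFunction.zeta : ArithmeticFunction ℝ)) =
      (Real.log x - 1) *
        dsum (divId g * (ArithmeticFunction.zeta : ArithmeticFunction ℝ)) (fun _ => 1) x -
      dsum (divId g * (ArithmeticFunction.zeta : ArithmeticFunction ℝ)) Real.log x +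
      dsum (divId g * stirlingTail) (fun _ => 1) x := by
  rw [logGcdSum, dsum, dsum, dsum, Finset.mul_sum, ← Finset.sum_sub_distrib,
    ← Finset.sum_add_distrib]
  refine Finset.sum_congr rfl fun k hk => ?_
  have hk₀ : k ≠ 0 := Nat.one_le_iff_ne_zero.mp (Finset.mem_Icc.mp hk).1
  rw [one_div_mul_sum_mul_zeta_gcd_log g hk₀, Real.log_div hx (by exact_mod_cast hk₀)]
  ring

/-! ### Asymptotics of the twisted sums -/

section

variable {a : ℝ}

lemma logBdd_zero_dsum_divId_moebiusR_sigmaR_one (ha : -1 < a) :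
    LogBdd 0 fun x => dsum (divId moebiusR) (dsum (sigmaR a) fun _ => 1) x -
      (zetaR (1 - a) / zetaR 2 * x + zetaR (1 + a) / (1 + a) / zetaR (2 + a) * x ^ (1 + a) +
        dsum (divId moebiusR) (Delta a) x) := by
  have hid := logBdd_zero_dsum_divId_moebiusR_rpow one_pos
  have hpow := logBdd_zero_dsum_divId_moebiusR_rpow (s := 1 + a) (by linarith)
  simp only [Real.rpow_one, one_add_one_eq_two, ← add_assoc] at hid hpow
  have hDelta : dsum (sigmaR a) (fun _ => 1) = fun y => zetaR (1 - a) * y +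
      zetaR (1 + a) / (1 + a) * y ^ (1 + a) - zetaR (-a) / 2 * 1 + Delta a y := by
    ext y
    simp only [dsum, Delta, mul_one]
    ring
  refine (((hid.const_mul_left (zetaR (1 - a))).add
    (hpow.const_mul_left (zetaR (1 + a) / (1 + a)))).sub
    (logBdd_zero_dsum_divId_moebiusR_one.const_mul_left (zetaR (-a) / 2))).congr_left fun x => ?_
  rw [hDelta, dsum_add, dsum_sub, dsum_add, dsum_const_mul, dsum_const_mul, dsum_const_mul]
  ring

lemma logBdd_one_dsum_divId_moebiusR_sigmaR_log (ha : -1 < a) (ha' : a < 0) :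
    LogBdd 1 fun x => dsum (divId moebiusR) (dsum (sigmaR a) Real.log) x -
      (zetaR (1 - a) / zetaR 2 * x +
        zetaR (1 + a) / (1 + a) ^ 2 / zetaR (2 + a) * x ^ (1 + a)) := by
  have hσ : LogBdd 0 fun y => dsum (sigmaR a) Real.log y - (zetaR (1 - a) * y +
      zetaR (1 + a) / (1 + a) ^ 2 * y ^ (1 + a) + -(zetaR (-a) / 2) * Real.log y) :=
    logBdd_zero_iff.mpr ((dsum_sigmaR_log_sub_isBigO ha ha').congr_left fun y => by ring)
  refine ((logBdd_dsum_divId_moebiusR_expansion (by linarith) hσ).add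
    (logBdd_one_dsum_divId_moebiusR_log.const_mul_left (-(zetaR (-a) / 2)))).congr_left fun x => ?_
  rw [dsum_const_mul, ← add_assoc, one_add_one_eq_two]
  ring

lemma divId_moebiusR_mul_divId_log :
    divId moebiusR * divId ArithmeticFunction.log = divId ArithmeticFunction.vonMangoldt := by
  rw [← divId_mul, moebiusR, ArithmeticFunction.moebius_mul_log_eq_vonMangoldt]

lemma divId_moebiusR_mul_divId_zeta :
    divId moebiusR * divId (ArithmeticFunction.zeta : ArithmeticFunction ℝ) = 1 := by
  rw [← divId_mul, moebiusR_mul_zeta, divId_one]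

lemma divId_moebiusR_mul_stirlingTail :
    divId moebiusR * stirlingTail = (1 / 2 : ℝ) • divId ArithmeticFunction.vonMangoldt +
      Real.log √(2 * Real.pi) • 1 + divId moebiusR * stirlingArith := by
  rw [stirlingTail, mul_add, mul_add, mul_smul_comm, mul_smul_comm, divId_moebiusR_mul_divId_log,
    divId_moebiusR_mul_divId_zeta]

lemma logBdd_one_dsum_divId_moebiusR_idPow_stirlingTail (ha : -1 < a) (ha' : a < 0) {Z : ℝ}
    (hZ : HasSum (fun l : ℕ => stirlingRem (l + 1) / ((l + 1 : ℕ) : ℝ) ^ (2 + a)) Z) :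
    LogBdd 1 fun x => dsum (divId moebiusR * idPow a * stirlingTail) (fun _ => 1) x -
      (1 / 2 * (-zetaR' (2 + a) / zetaR (2 + a) / (1 + a)) +
        Real.log √(2 * Real.pi) / (1 + a) + Z / (1 + a) / zetaR (2 + a)) * x ^ (1 + a) := by
  have hlog := (logBdd_one_dsum_divId_vonMangoldt_idPow ha ha').const_mul_left (1 / 2)
  have hone := (LogBdd.mono (logBdd_zero_dsum_idPow_one_sub ha ha') zero_le_one).const_mul_left
    (Real.log √(2 * Real.pi))
  have hrem : LogBdd 0 fun y => dsum stirlingArith (dsum (idPow a) fun _ => 1) y -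
      (0 * y + Z / (1 + a) * y ^ (1 + a) + 0) := by
    simpa only [zero_mul, zero_add, add_zero] using logBdd_zero_dsum_stirlingArith_idPow ha ha' hZ
  refine ((hlog.add hone).add
    (logBdd_dsum_divId_moebiusR_expansion (by linarith) hrem)).congr_left fun x => ?_
  rw [mul_right_comm, divId_moebiusR_mul_stirlingTail, add_mul, add_mul, smul_mul_assoc,
    smul_mul_assoc, one_mul, dsum_coeff_add, dsum_coeff_add, dsum_coeff_smul, dsum_coeff_smul,
    dsum_mul, dsum_mul (_ * _), dsum_mul (divId moebiusR), dsum_const _ 0, ← add_assoc,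
    one_add_one_eq_two]
  ring

end

lemma mul_idPow_mul_zeta (c : ArithmeticFunction ℝ) (a : ℝ) :
    c * idPow a * (ArithmeticFunction.zeta : ArithmeticFunction ℝ) = c * sigmaR a := by
  rw [sigmaR, mul_assoc, mul_comm (idPow a)]

lemma moebiusR_mul_mul_zeta (c : ArithmeticFunction ℝ) :
    moebiusR * c * (ArithmeticFunction.zeta : ArithmeticFunction ℝ) = c := by
  rw [mul_right_comm, moebiusR_mul_zeta, one_mul]

lemma logGcdSum_mul_idPow (h : ArithmeticFunction ℝ) (a : ℝ) {x : ℝ} (hx : x ≠ 0) :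
    logGcdSum x (h * idPow (1 + a) * (ArithmeticFunction.zeta : ArithmeticFunction ℝ)) =
      (Real.log x - 1) * dsum (divId h) (dsum (sigmaR a) fun _ => 1) x -
        dsum (divId h) (dsum (sigmaR a) Real.log) x +
        dsum (divId h * idPow a * stirlingTail) (fun _ => 1) x := by
  rw [logGcdSum_mul_zeta _ hx, divId_mul, divId_idPow, mul_idPow_mul_zeta, dsum_mul, dsum_mul]

lemma deltaSum_eq_dsum (g : ArithmeticFunction ℝ) (a x : ℝ) :
    deltaSum g a x = dsum (divId g) (Delta a) x := rfl

lemma log_div_exp_one {x : ℝ} (hx : x ≠ 0) : Real.log (x / Real.exp 1) = Real.log x - 1 := by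
  rw [Real.log_div hx (Real.exp_ne_zero 1), Real.log_exp]

section

variable {a : ℝ}

lemma logBdd_one_logGcdSum_idPow_sub (ha : -1 < a) (ha' : a < 0) {Z : ℝ}
    (hZ : HasSum (fun l : ℕ => stirlingRem (l + 1) / ((l + 1 : ℕ) : ℝ) ^ (2 + a)) Z) :
    LogBdd 1 fun x => logGcdSum x (idPow (1 + a)) -
      (zetaR (1 - a) / zetaR 2 * x * Real.log x
        - 2 * zetaR (1 - a) / zetaR 2 * x
        + zetaR (1 + a) / ((1 + a) * zetaR (2 + a)) * x ^ (1 + a) * Real.log x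
        - 1 / ((1 + a) * zetaR (2 + a)) *
            ((2 + a) * zetaR (1 + a) / (1 + a) + zetaR' (2 + a) / 2 - Z) * x ^ (1 + a)
        + Real.log √(2 * Real.pi) / (1 + a) * x ^ (1 + a)
        + deltaSum moebiusR a x * Real.log (x / Real.exp 1)) := by
  refine (((logBdd_zero_dsum_divId_moebiusR_sigmaR_one ha).log_sub_one_mul.sub
    (logBdd_one_dsum_divId_moebiusR_sigmaR_log ha ha')).add
    (logBdd_one_dsum_divId_moebiusR_idPow_stirlingTail ha ha' hZ)).congr'
    (eventually_principal.mpr fun x (hx : 1 ≤ x) => ?_) EventuallyEq.rfl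
  have hx₀ : x ≠ 0 := (one_pos.trans_le hx).ne'
  have ha₁ : 1 + a ≠ 0 := by linarith
  have hdecomp := logGcdSum_mul_idPow moebiusR a hx₀
  rw [moebiusR_mul_mul_zeta] at hdecomp
  simp only [hdecomp, deltaSum_eq_dsum, log_div_exp_one hx₀]
  field_simp
  ring

lemma logBdd_two_logGcdSum_jordan_sub (ha : -1 < a) (ha' : a < 0) {Z : ℝ}
    (hZ : HasSum (fun l : ℕ => stirlingRem (l + 1) / ((l + 1 : ℕ) : ℝ) ^ (2 + a)) Z) :
    LogBdd 2 fun x => logGcdSum x (jordan (1 + a)) -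
      (zetaR (1 - a) / zetaR 2 ^ 2 * x * Real.log x
        - 2 * zetaR (1 - a) / zetaR 2 ^ 2 * x
        + zetaR (1 + a) / ((1 + a) * zetaR (2 + a) ^ 2) * x ^ (1 + a) * Real.log x
        - 1 / ((1 + a) * zetaR (2 + a) ^ 2) *
            ((2 + a) * zetaR (1 + a) / (1 + a) + zetaR' (2 + a) / 2 - Z) * x ^ (1 + a)
        + Real.log √(2 * Real.pi) / ((1 + a) * zetaR (2 + a)) * x ^ (1 + a)
        + deltaSum (moebiusR * moebiusR) a x * Real.log (x / Real.exp 1)) := by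
  have hpos : 0 < 1 + a := by linarith
  have hone := (logBdd_dsum_divId_moebiusR_expansion hpos
    (logBdd_zero_dsum_divId_moebiusR_sigmaR_one ha)).log_sub_one_mul
  have hlog := logBdd_dsum_divId_moebiusR_expansion hpos (D := fun _ => 0) (k := 1)
    ((logBdd_one_dsum_divId_moebiusR_sigmaR_log ha ha').congr_left fun x => by rw [add_zero])
  have htail := logBdd_dsum_divId_moebiusR_expansion hpos (α := 0) (D := fun _ => 0) (k := 1)
    ((logBdd_one_dsum_divId_moebiusR_idPow_stirlingTail ha ha' hZ).congr_left fun x => by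
      rw [add_zero, zero_mul, zero_add])
  refine ((hone.sub hlog).add htail).congr'
    (eventually_principal.mpr fun x (hx : 1 ≤ x) => ?_) EventuallyEq.rfl
  have hx₀ : x ≠ 0 := (one_pos.trans_le hx).ne'
  have hdecomp := logGcdSum_mul_idPow (moebiusR * moebiusR) a hx₀
  rw [mul_assoc moebiusR, ← jordan, moebiusR_mul_mul_zeta, divId_mul, mul_assoc (divId moebiusR),
    mul_assoc (divId moebiusR)] at hdecomp
  simp only [hdecomp, deltaSum_eq_dsum, log_div_exp_one hx₀, divId_mul, dsum_mul, dsum_const _ 0,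
    zero_mul, ← add_assoc, one_add_one_eq_two]
  field_simp
  ring

end

end LogGcdSum

end

open LogGcdSum in
theorem theorem5 (a : ℝ) (ha : -1 < a) (ha' : a < 0) :
    ∃ Θ : ℝ, 0 < Θ ∧ Θ < 1 / 12 ∧
      HasSum (fun l : ℕ => stirlingRem (l + 1) / ((l + 1 : ℕ) : ℝ) ^ (2 + a))
        (Θ * zetaR (3 + a)) ∧
      ((fun x : ℝ => logGcdSum x (idPow (1 + a)) -
          (zetaR (1 - a) / zetaR 2 * x * Real.log x
            - 2 * zetaR (1 - a) / zetaR 2 * x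
            + zetaR (1 + a) / ((1 + a) * zetaR (2 + a)) * x ^ (1 + a) * Real.log x
            - 1 / ((1 + a) * zetaR (2 + a)) *
                ((2 + a) * zetaR (1 + a) / (1 + a) + zetaR' (2 + a) / 2
                  - Θ * zetaR (3 + a)) * x ^ (1 + a)
            + Real.log (Real.sqrt (2 * Real.pi)) / (1 + a) * x ^ (1 + a)
            + deltaSum moebiusR a x * Real.log (x / Real.exp 1)))
        =O[atTop] fun x : ℝ => Real.log x) ∧
      ((fun x : ℝ => logGcdSum x (jordan (1 + a)) -
          (zetaR (1 - a) / zetaR 2 ^ 2 * x * Real.log x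
            - 2 * zetaR (1 - a) / zetaR 2 ^ 2 * x
            + zetaR (1 + a) / ((1 + a) * zetaR (2 + a) ^ 2) * x ^ (1 + a) * Real.log x
            - 1 / ((1 + a) * zetaR (2 + a) ^ 2) *
                ((2 + a) * zetaR (1 + a) / (1 + a) + zetaR' (2 + a) / 2
                  - Θ * zetaR (3 + a)) * x ^ (1 + a)
            + Real.log (Real.sqrt (2 * Real.pi)) / ((1 + a) * zetaR (2 + a)) * x ^ (1 + a)
            + deltaSum (moebiusR * moebiusR) a x * Real.log (x / Real.exp 1)))
        =O[atTop] fun x : ℝ => Real.log x ^ 3) := by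
  obtain ⟨Θ, hΘ₀, hΘ₁, hΘ⟩ := exists_hasSum_stirlingRem (by linarith : -2 < a)
  refine ⟨Θ, hΘ₀, hΘ₁, hΘ, ?_, ?_⟩
  · simpa only [pow_one] using (logBdd_one_logGcdSum_idPow_sub ha ha' hΘ).isBigO_atTop
  · exact ((logBdd_two_logGcdSum_jordan_sub ha ha' hΘ).mono (by norm_num)).isBigO_atTop
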